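/- **Setting.** Let $A$ be an instance of the stable matching problem with finitely many boys and girls and strict, possibly incomplete preference lists ($b$ is on $g$'s list iff $g$ is on $b$'s list). A matching (of mutually acceptable pairs) is stable if no mutually acceptable pair $bg$ is blocking, i.e. such that each of $b,g$ is unmatched or strictly prefers the other to its partner. $M\preceq M'$ means that every boy weakly prefers his partner in $M$. The stable matchings form a lattice $\mathcal L_A$ under $\preceq$, in which the meet (join) gives every boy the better (worse) of his two partners; $M_0$ is its least element, the boy-optimal matching. *Rotations.* For a stable matching $M$ and a boy $b$ let $s_M(b)$ be the first girl on $b$'s list who is unmatched in $M$ or strictly prefers $b$ to her $M$-partner. A rotation exposed in $M$ is a nonempty cyclic sequence $\rho$ of distinct pairs $b_0g_0,\dots,b_{r-1}g_{r-1}$ of $M$ with $s_M(b_i)=g_{i+1}$ (subscripts mod $r$); eliminating it from $M$ gives the matching $M/\rho$ in which each $b_i$ is matched to $g_{i+1}$ and every other boy keeps his situation. The rotation poset $\Pi$ is the set of all rotations exposed in some stable matching, with $\rho\preceq\sigma$ iff $\rho=\sigma$ or every sequence of eliminations from $M_0$ to a matching exposing $\sigma$ contains $\rho$. A closed set of a poset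 is a subset that contains all predecessors of its elements. *Errors.* Let $D$ be the set of all upward shifts: a shift moves one agent of one list up to the place directly above some agent that precedes it in that list. Let $p$ be a probability distribution on $D$. A robust stable matching is a stable matching $M$ of $A$ that maximizes, among all stable matchings of $A$, the probability that $M$ is stable for the instance $B$ obtained by a $p$-random shift. Let $\mathcal L_0$ be the set of robust stable matchings. *Network.* For a shift $B$ (and the resulting instance) let $\mathcal M_{AB}$ be the set of matchings stable for $A$ but not for $B$. Let $\rho^B_{\rm in}$ be the rotation (there is at most one) with $M\notin\mathcal M_{AB}$ and $M/\rho\in\mathcal M_{AB}$ for some stable matching $M$ of $A$ in which it is exposed, and $\rho^B_{\rm out}$ the rotation (there is at most one) with $M\in\mathcal M_{AB}$ and $M/\rho\notin\mathcal M_{AB}$ for some such $M$. Add to $\Pi$ a vertex $s$ preceding all others and a vertex $t$ succeeding all others. The network $N$ has these vertices, the edges of the Hasse diagram of $\Pi\cup\{s,t\}$, directed from smaller to larger elements, with infinite capacity, and for each $B\in D$ for which $\rho^B_{\rm in}$ or $\rho^B_{\rm out}$ exists an edge from $\rho^B_{\rm out}$ (or $t$ if this rotation does not exist) to $\rho^B_{\rm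 in}$ (or $s$ if this rotation does not exist), with capacity $p_B$. Given a maximum flow from $t$ to $s$ in $N$, the residual graph $G$ has an edge $(u,v)$ for every network edge $(u,v)$ with flow below its capacity and for every network edge $(v,u)$ with positive flow. Let $\Pi_0$ be the poset whose elements are the strongly connected components of $G$, with $x\preceq y$ iff there is a (possibly trivial) path from $x$ to $y$ in the acyclic graph obtained from $G$ by contracting these components. Call a closed set of $\Pi_0$ *proper* if it contains the component of $s$ and not that of $t$ (equivalently, if it is neither empty nor all of $\Pi_0$). **Lemma.** A maximum flow from $t$ to $s$ exists, and for every maximum flow the poset $\Pi_0$ generates $\mathcal L_0$. That is, $\mathcal L_0$ is a sublattice of $\mathcal L_A$ (closed under its meet and join), and there is a bijection $S\mapsto M_S$ from the proper closed sets of $\Pi_0$ onto the robust stable matchings such that for all proper closed $S,T$: 1. $S\subseteq T$ iff $M_S\preceq M_T$, and $M_{S\cap T}=M_S\wedge M_T$, $M_{S\cup T}=M_S\vee M_T$; 2. the set $U$ of all rotations that lie in the union of the components belonging to $S$ is a closed set of $\Pi$; it can be listed in an order consistent with a topological sort of $\Pi$; and, for every such order, starting from $M_0$ and eliminating the rotations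 of $U$ in this order is possible (each is exposed when its turn comes) and yields $M_S$. -/

import Mathlib

namespace RobustSM

section Lists

variable {α : Type*} [DecidableEq α]

/-- The list obtained from `l` by taking `x` out and putting it back directly in front of `y`. -/
def moveUp (l : List α) (x y : α) : List α :=
  (l.erase x).takeWhile (fun z => decide (z ≠ y)) ++
    x :: (l.erase x).dropWhile (fun z => decide (z ≠ y))

theorem moveUp_perm {l : List α} {x : α} (y : α) (hx : x ∈ l) : (moveUp l x y).Perm l := by
  unfold moveUp
  refine List.perm_middle.trans ?_
  rw [List.takeWhile_append_dropWhile]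
  exact (List.perm_cons_erase hx).symm

/-- `moveUp` is the upward shift: `…, y, …, x, …` becomes `…, x, y, …, …`. -/
theorem moveUp_eq (l₁ l₂ l₃ : List α) (x y : α) (h : (l₁ ++ y :: l₂ ++ x :: l₃).Nodup) :
    moveUp (l₁ ++ y :: l₂ ++ x :: l₃) x y = l₁ ++ x :: y :: l₂ ++ l₃ := by
  have hx : x ∉ l₁ ++ y :: l₂ := by
    intro hm
    exact (List.nodup_append.1 h).2.2 x hm x (by simp) rfl
  have hy : ∀ z ∈ l₁, decide (z ≠ y) = true := by
    intro z hz
    have h' : (l₁ ++ y :: (l₂ ++ x :: l₃)).Nodup := by simpa using h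
    simpa using (List.nodup_append.1 h').2.2 z hz y (by simp)
  unfold moveUp
  rw [List.erase_append_right _ hx, List.erase_cons_head, List.append_assoc,
    List.takeWhile_append_of_pos hy, List.dropWhile_append_of_pos hy]
  simp

end Lists

/-- An instance of stable matching with (possibly) incomplete preference lists. Lists run from most
to least preferred. `b` and `g` are joined in the acceptability graph when each is on the other's
list; the instance has complete lists when every list contains everybody. -/
structure SMInstance (Boy Girl : Type*) where
  boyList : Boy → List Girl
  girlList : Girl → List Boy
  boyList_nodup : ∀ b, (boyList b).Nodup
  girlList_nodup : ∀ g, (girlList g).Nodup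
  mem_iff : ∀ b g, g ∈ boyList b ↔ b ∈ girlList g

variable {Boy Girl : Type*} [DecidableEq Boy] [DecidableEq Girl]

/-- `b` strictly prefers `g` to `g'`. (`idxOf` of a non-member is the length of the list, so listed
agents are preferred to unlisted ones.) -/
def SMInstance.BoyPrefers (A : SMInstance Boy Girl) (b : Boy) (g g' : Girl) : Prop :=
  (A.boyList b).idxOf g < (A.boyList b).idxOf g'

/-- `g` strictly prefers `b` to `b'`. -/
def SMInstance.GirlPrefers (A : SMInstance Boy Girl) (g : Girl) (b b' : Boy) : Prop :=
  (A.girlList g).idxOf b < (A.girlList g).idxOf b'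

/-- A pairing of boys and girls: `M b` is the partner of `b` and `M.symm g` that of `g`, `none` for
an unmatched agent. -/
abbrev Pairing (Boy Girl : Type*) := Boy ≃. Girl

/-- `b` and `g` accept each other, and each of them is unmatched or strictly prefers the other to
the partner in `M`. (By strictness such a pair is not in `M`.) -/
def Blocks (A : SMInstance Boy Girl) (M : Pairing Boy Girl) (b : Boy) (g : Girl) : Prop :=
  g ∈ A.boyList b ∧ (∀ g' ∈ M b, A.BoyPrefers b g g') ∧ (∀ b' ∈ M.symm g, A.GirlPrefers g b b')

/-- Stable matchings of `A`. -/
def Stable (A : SMInstance Boy Girl) (M : Pairing Boy Girl) : Prop :=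
  (∀ b, ∀ g ∈ M b, g ∈ A.boyList b) ∧ ∀ b g, ¬ Blocks A M b g

/-! ### The lattice of stable matchings -/

/-- Position of an outcome in `b`'s list; being unmatched comes last. -/
def boyRank (A : SMInstance Boy Girl) (b : Boy) : Option Girl → ℕ
  | none => (A.boyList b).length
  | some g => (A.boyList b).idxOf g

/-- `M ⪯ N`: every boy weakly prefers his partner in `M`. -/
def Dominates (A : SMInstance Boy Girl) (M N : Pairing Boy Girl) : Prop :=
  ∀ b, boyRank A b (M b) ≤ boyRank A b (N b)

/-- `N = M ∧ M'`: every boy gets his more preferred partner from `M` and `M'`. -/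
def IsMeet (A : SMInstance Boy Girl) (M M' N : Pairing Boy Girl) : Prop :=
  ∀ b, N b = if boyRank A b (M b) ≤ boyRank A b (M' b) then M b else M' b

/-- `N = M ∨ M'`: every boy gets his less preferred partner from `M` and `M'`. -/
def IsJoin (A : SMInstance Boy Girl) (M M' N : Pairing Boy Girl) : Prop :=
  ∀ b, N b = if boyRank A b (M b) ≤ boyRank A b (M' b) then M' b else M b

/-- A set of stable matchings closed under the meet and the join of the lattice of all stable
matchings. -/
def IsStableSublattice (A : SMInstance Boy Girl) (X : Set (Pairing Boy Girl)) : Prop :=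
  (∀ M ∈ X, Stable A M) ∧
    ∀ M ∈ X, ∀ M' ∈ X, (∃ N ∈ X, IsMeet A M M' N) ∧ (∃ N ∈ X, IsJoin A M M' N)

/-- The boy-optimal matching `M₀`. -/
def IsBoyOptimal (A : SMInstance Boy Girl) (M₀ : Pairing Boy Girl) : Prop :=
  Stable A M₀ ∧ ∀ M, Stable A M → Dominates A M₀ M

/-! ### Rotations -/

/-- `s_M(b)`: the first girl on `b`'s list who strictly prefers `b` to her situation in `M`. -/
noncomputable def sGirl (A : SMInstance Boy Girl) (M : Pairing Boy Girl) (b : Boy) : Option Girl :=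
  open Classical in
  (A.boyList b).find? (fun g => decide (∀ b' ∈ M.symm g, A.GirlPrefers g b b'))

/-- The cyclic sequence of distinct pairs `(b₀,g₀), …, (b_{r-1},g_{r-1})` is a rotation exposed in
`M`: the pairs belong to `M` and `s_M(b_i) = g_{i+1}` (so that `b_{i+1}` is the `M`-partner of
`s_M(b_i)`), subscripts modulo `r`. -/
def Exposed (A : SMInstance Boy Girl) (M : Pairing Boy Girl) (ρ : Cycle (Boy × Girl)) : Prop :=
  ρ.Nodup ∧ ρ ≠ Cycle.nil ∧ (∀ q ∈ ρ, M q.1 = some q.2) ∧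
    ρ.Chain (fun q q' => sGirl A M q.1 = some q'.2)

/-- The rotations of `A`: those exposed in some stable matching. -/
def Rotation (A : SMInstance Boy Girl) : Type _ :=
  {ρ : Cycle (Boy × Girl) // ∃ M, Stable A M ∧ Exposed A M ρ}

instance [Fintype Boy] [Fintype Girl] (A : SMInstance Boy Girl) : Finite (Rotation A) :=
  Finite.of_injective
    (fun ρ : Rotation A =>
      (⟨ρ.1, ρ.2.elim fun _ h => h.2.1⟩ : {c : Cycle (Boy × Girl) // c.Nodup}))
    (fun _ _ h => Subtype.ext (congrArg (fun c => c.1) h))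

noncomputable instance [Fintype Boy] [Fintype Girl] (A : SMInstance Boy Girl) :
    Fintype (Rotation A) := Fintype.ofFinite _

/-- `N = M / ρ`: the rotation `ρ` is exposed in `M` and its elimination gives `N`. -/
def Eliminates (A : SMInstance Boy Girl) (M : Pairing Boy Girl) (ρ : Rotation A)
    (N : Pairing Boy Girl) : Prop :=
  Exposed A M ρ.1 ∧ (∀ q ∈ ρ.1, N q.1 = sGirl A M q.1) ∧ ∀ b, (∀ g, (b, g) ∉ ρ.1) → N b = M b

/-- Eliminating the rotations of the list one after the other, starting from `M`, is possible (each
rotation is exposed when its turn comes) and ends in `N`. -/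
def ElimSeq (A : SMInstance Boy Girl) :
    Pairing Boy Girl → List (Rotation A) → Pairing Boy Girl → Prop
  | M, [], N => M = N
  | M, ρ :: l, N => ∃ M', Eliminates A M ρ M' ∧ ElimSeq A M' l N

/-- `ρ ⪯ σ` in the rotation poset: `ρ` is `σ`, or every sequence of eliminations leading from the
boy-optimal matching to a matching in which `σ` is exposed contains `ρ`. -/
def RotLE (A : SMInstance Boy Girl) (ρ σ : Rotation A) : Prop :=
  ρ = σ ∨ ∀ M₀ l M, IsBoyOptimal A M₀ → ElimSeq A M₀ l M → Exposed A M σ.1 → ρ ∈ l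

theorem ElimSeq.split {A : SMInstance Boy Girl} {σ : Rotation A} {l₂ : List (Rotation A)}
    {N : Pairing Boy Girl} : ∀ {l₁ : List (Rotation A)} {M : Pairing Boy Girl},
    ElimSeq A M (l₁ ++ σ :: l₂) N → ∃ M', ElimSeq A M l₁ M' ∧ Exposed A M' σ.1
  | [], M, h => by
    obtain ⟨M', h1, _⟩ := h
    exact ⟨M, rfl, h1.1⟩
  | τ :: l₁, M, h => by
    obtain ⟨M', h1, h2⟩ := h
    obtain ⟨M'', h3, h4⟩ := ElimSeq.split h2
    exact ⟨M'', ⟨M', h1, h3⟩, h4⟩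

/-- The rotation poset. (Antisymmetry is a theorem about stable matchings, not needed here.) -/
instance (A : SMInstance Boy Girl) : Preorder (Rotation A) where
  le := RotLE A
  le_refl _ := Or.inl rfl
  le_trans ρ σ τ h1 h2 := by
    rcases h1 with rfl | h1
    · exact h2
    rcases h2 with rfl | h2
    · exact Or.inr h1
    refine Or.inr fun M₀ l M h0 hl hM => ?_
    obtain ⟨l₁, l₂, rfl⟩ := List.append_of_mem (h2 M₀ l M h0 hl hM)
    obtain ⟨M', h3, h4⟩ := hl.split
    exact List.mem_append_left _ (h1 M₀ l₁ M' h0 h3 h4)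

/-- `l` lists the rotations of `U`, once each, in an order consistent with a topological sort of the
rotation poset. -/
def IsTopologicalOrder (A : SMInstance Boy Girl) (U : Set (Rotation A)) (l : List (Rotation A)) :
    Prop :=
  l.Nodup ∧ (∀ ρ, ρ ∈ l ↔ ρ ∈ U) ∧ l.Pairwise (fun ρ σ => ¬ σ < ρ)

/-- `U` generates `M`: it is a closed set of the rotation poset, and starting from the boy-optimal
matching one can apply all rotations of `U` in any order consistent with a topological sort, always
arriving at `M`. -/
def Generates (A : SMInstance Boy Girl) (U : Set (Rotation A)) (M : Pairing Boy Girl) : Prop :=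
  IsLowerSet U ∧ ∃ M₀, IsBoyOptimal A M₀ ∧ (∃ l, IsTopologicalOrder A U l) ∧
    ∀ l, IsTopologicalOrder A U l → ElimSeq A M₀ l M

/-! ### Errors and robust matchings -/

/-- The domain of errors: all upward shifts. `Sum.inl (g, b, b₁)`, where `b₁` is above `b` in the
list of `g`, is the shift that moves `b` up to the place directly above `b₁`; `Sum.inr (b, g, g₁)`
is the analogous shift in the list of `b`. -/
def Shift (A : SMInstance Boy Girl) : Type _ :=
  {x : Girl × Boy × Boy // x.2.1 ∈ A.girlList x.1 ∧ A.GirlPrefers x.1 x.2.2 x.2.1} ⊕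
    {x : Boy × Girl × Girl // x.2.1 ∈ A.boyList x.1 ∧ A.BoyPrefers x.1 x.2.2 x.2.1}

instance [Fintype Boy] [Fintype Girl] (A : SMInstance Boy Girl) : Finite (Shift A) :=
  inferInstanceAs (Finite (_ ⊕ _))

noncomputable instance [Fintype Boy] [Fintype Girl] (A : SMInstance Boy Girl) :
    Fintype (Shift A) := Fintype.ofFinite _

/-- The instance that results from the shift. -/
def SMInstance.applyShift (A : SMInstance Boy Girl) : Shift A → SMInstance Boy Girl
  | Sum.inl x =>
    { A with
      girlList := Function.update A.girlList x.1.1 (moveUp (A.girlList x.1.1) x.1.2.1 x.1.2.2)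
      girlList_nodup := fun g => by
        by_cases h : g = x.1.1
        · subst h
          simpa using (moveUp_perm x.1.2.2 x.2.1).nodup_iff.2 (A.girlList_nodup _)
        · simpa [h] using A.girlList_nodup g
      mem_iff := fun b g => by
        by_cases h : g = x.1.1
        · subst h
          simpa using (A.mem_iff b _).trans (moveUp_perm x.1.2.2 x.2.1).mem_iff.symm
        · simpa [h] using A.mem_iff b g }
  | Sum.inr x =>
    { A with
      boyList := Function.update A.boyList x.1.1 (moveUp (A.boyList x.1.1) x.1.2.1 x.1.2.2)
      boyList_nodup := fun b => by
        by_cases h : b = x.1.1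
        · subst h
          simpa using (moveUp_perm x.1.2.2 x.2.1).nodup_iff.2 (A.boyList_nodup _)
        · simpa [h] using A.boyList_nodup b
      mem_iff := fun b g => by
        by_cases h : b = x.1.1
        · subst h
          simpa using (moveUp_perm x.1.2.2 x.2.1).mem_iff.trans (A.mem_iff _ g)
        · simpa [h] using A.mem_iff b g }

/-- The probability that `M` is stable for the instance resulting from a random shift. -/
noncomputable def probStable [Fintype Boy] [Fintype Girl] (A : SMInstance Boy Girl) (p : Shift A → ℝ)
    (M : Pairing Boy Girl) : ℝ :=
  open Classical in
  ∑ B : Shift A, if Stable (A.applyShift B) M then p B else 0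

/-- The robust stable matchings: the stable matchings of `A` with the highest probability of being
stable after the error. -/
def robustSet [Fintype Boy] [Fintype Girl] (A : SMInstance Boy Girl) (p : Shift A → ℝ) :
    Set (Pairing Boy Girl) :=
  {M | Stable A M ∧ ∀ N, Stable A N → probStable A p N ≤ probStable A p M}

/-! ### The network -/

/-- The stable matchings of `A` that are not stable after the shift `B`. -/
def lostSet (A : SMInstance Boy Girl) (B : Shift A) : Set (Pairing Boy Girl) :=
  {M | Stable A M ∧ ¬ Stable (A.applyShift B) M}

/-- The rotations going into the lost set of `B` (there is at most one). -/
def rotationsInto (A : SMInstance Boy Girl) (B : Shift A) : Set (Rotation A) :=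
  {ρ | ∃ M N, Stable A M ∧ M ∉ lostSet A B ∧ Eliminates A M ρ N ∧ N ∈ lostSet A B}

/-- The rotations going out of the lost set of `B` (there is at most one). -/
def rotationsOutOf (A : SMInstance Boy Girl) (B : Shift A) : Set (Rotation A) :=
  {ρ | ∃ M N, M ∈ lostSet A B ∧ Eliminates A M ρ N ∧ Stable A N ∧ N ∉ lostSet A B}

/-- The vertices of the network: the rotations, the vertex `s = ⊥` preceding all others and the
vertex `t = ⊤` succeeding all others. -/
abbrev Vertex (A : SMInstance Boy Girl) : Type _ := WithBot (WithTop (Rotation A))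

/-- The vertex belonging to a rotation. -/
def rotVertex {A : SMInstance Boy Girl} (ρ : Rotation A) : Vertex A :=
  ((ρ : WithTop (Rotation A)) : WithBot (WithTop (Rotation A)))

/-- `ρ_in` of the shift `B`, and `s` if there is none. -/
noncomputable def inVertex (A : SMInstance Boy Girl) (B : Shift A) : Vertex A :=
  open Classical in
  if h : (rotationsInto A B).Nonempty then rotVertex h.some else ⊥

/-- `ρ_out` of the shift `B`, and `t` if there is none. -/
noncomputable def outVertex (A : SMInstance Boy Girl) (B : Shift A) : Vertex A :=
  open Classical in
  if h : (rotationsOutOf A B).Nonempty then rotVertex h.some else ⊤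

/-- The edges `E(H)` of the Hasse diagram of the rotation poset with `s` and `t`, directed upwards.
Their capacity is infinite. -/
abbrev HasseEdge (A : SMInstance Boy Girl) : Type _ := {e : Vertex A × Vertex A // e.1 ⋖ e.2}

/-- The edges `F`: an edge `(ρ_out, ρ_in)` of capacity `p B` for every shift `B` for which at least
one of the two rotations exists. Different shifts give parallel edges. -/
abbrev ErrorEdge (A : SMInstance Boy Girl) : Type _ :=
  {B : Shift A // (rotationsInto A B).Nonempty ∨ (rotationsOutOf A B).Nonempty}

noncomputable instance [Fintype Boy] [Fintype Girl] (A : SMInstance Boy Girl) :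
    Fintype (HasseEdge A) := Fintype.ofFinite _

noncomputable instance [Fintype Boy] [Fintype Girl] (A : SMInstance Boy Girl) :
    Fintype (ErrorEdge A) := Fintype.ofFinite _

/-- An assignment of numbers to the edges in `E(H)` (`f`) and in `F` (`g`). -/
structure EdgeFlow (A : SMInstance Boy Girl) where
  f : HasseEdge A → ℝ
  g : ErrorEdge A → ℝ

/-- Total flow on the edges leaving `u`. -/
noncomputable def EdgeFlow.outflow [Fintype Boy] [Fintype Girl] {A : SMInstance Boy Girl}
    (φ : EdgeFlow A) (u : Vertex A) : ℝ :=
  open Classical in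
  (∑ e : HasseEdge A, if e.1.1 = u then φ.f e else 0) +
    ∑ B : ErrorEdge A, if outVertex A B.1 = u then φ.g B else 0

/-- Total flow on the edges entering `u`. -/
noncomputable def EdgeFlow.inflow [Fintype Boy] [Fintype Girl] {A : SMInstance Boy Girl}
    (φ : EdgeFlow A) (u : Vertex A) : ℝ :=
  open Classical in
  (∑ e : HasseEdge A, if e.1.2 = u then φ.f e else 0) +
    ∑ B : ErrorEdge A, if inVertex A B.1 = u then φ.g B else 0

/-- Feasible flows from `t` to `s`: nonnegativity, capacities, conservation at the other vertices. -/
def EdgeFlow.IsFeasible [Fintype Boy] [Fintype Girl] {A : SMInstance Boy Girl}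
    (p : Shift A → ℝ) (φ : EdgeFlow A) : Prop :=
  (∀ e, 0 ≤ φ.f e) ∧ (∀ B, 0 ≤ φ.g B ∧ φ.g B ≤ p B.1) ∧
    ∀ u, u ≠ ⊥ → u ≠ ⊤ → φ.inflow u = φ.outflow u

/-- The value of the flow: the net amount leaving `t`. -/
noncomputable def EdgeFlow.value [Fintype Boy] [Fintype Girl] {A : SMInstance Boy Girl}
    (φ : EdgeFlow A) : ℝ :=
  φ.outflow ⊤ - φ.inflow ⊤

/-- `φ` is a maximum flow from `t` to `s`. -/
def EdgeFlow.IsMaximum [Fintype Boy] [Fintype Girl] {A : SMInstance Boy Girl}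
    (p : Shift A → ℝ) (φ : EdgeFlow A) : Prop :=
  φ.IsFeasible p ∧ ∀ ψ : EdgeFlow A, ψ.IsFeasible p → ψ.value ≤ φ.value

/-- The edges of the residual graph: forward copies of edges below capacity (always for edges of the
Hasse diagram), reversed copies of edges with positive flow. -/
def EdgeFlow.Residual {A : SMInstance Boy Girl} (p : Shift A → ℝ) (φ : EdgeFlow A)
    (u v : Vertex A) : Prop :=
  (∃ e : HasseEdge A, e.1.1 = u ∧ e.1.2 = v) ∨
  (∃ e : HasseEdge A, e.1.1 = v ∧ e.1.2 = u ∧ 0 < φ.f e) ∨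
  (∃ B : ErrorEdge A, outVertex A B.1 = u ∧ inVertex A B.1 = v ∧ φ.g B < p B.1) ∨
  (∃ B : ErrorEdge A, outVertex A B.1 = v ∧ inVertex A B.1 = u ∧ 0 < φ.g B)

/-! ### The partial order `Π₀` -/

/-- There is a path (possibly trivial) from `u` to `v` in the residual graph. -/
def EdgeFlow.Reach {A : SMInstance Boy Girl} (p : Shift A → ℝ) (φ : EdgeFlow A) :
    Vertex A → Vertex A → Prop :=
  Relation.ReflTransGen (φ.Residual p)

/-- The strongly connected component of `v` in the residual graph. -/
def EdgeFlow.component {A : SMInstance Boy Girl} (p : Shift A → ℝ) (φ : EdgeFlow A)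
    (v : Vertex A) : Set (Vertex A) :=
  {w | φ.Reach p v w ∧ φ.Reach p w v}

/-- The elements of `Π₀`: the strongly connected components of the residual graph. -/
def Pi0 {A : SMInstance Boy Girl} (p : Shift A → ℝ) (φ : EdgeFlow A) : Type _ :=
  {C : Set (Vertex A) // ∃ v, C = φ.component p v}

/-- The component of a vertex as an element of `Π₀`. -/
def Pi0.of {A : SMInstance Boy Girl} (p : Shift A → ℝ) (φ : EdgeFlow A) (v : Vertex A) :
    Pi0 p φ := ⟨φ.component p v, v, rfl⟩

/-- The edges of the graph that results from contracting the components. -/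
def Pi0.Edge {A : SMInstance Boy Girl} {p : Shift A → ℝ} {φ : EdgeFlow A} (C D : Pi0 p φ) : Prop :=
  C ≠ D ∧ ∃ x ∈ C.1, ∃ y ∈ D.1, φ.Residual p x y

theorem Pi0.reach_of_mem {A : SMInstance Boy Girl} {p : Shift A → ℝ} {φ : EdgeFlow A}
    (C : Pi0 p φ) {x y : Vertex A} (hx : x ∈ C.1) (hy : y ∈ C.1) : φ.Reach p x y := by
  obtain ⟨C, v, rfl⟩ := C
  exact hx.2.trans hy.1

theorem Pi0.reach_of_path {A : SMInstance Boy Girl} {p : Shift A → ℝ} {φ : EdgeFlow A}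
    {C D : Pi0 p φ} (h : Relation.ReflTransGen Pi0.Edge C D) {x y : Vertex A} (hx : x ∈ C.1)
    (hy : y ∈ D.1) : φ.Reach p x y := by
  induction h generalizing y with
  | refl => exact C.reach_of_mem hx hy
  | tail _ hE ih =>
    obtain ⟨_, a, ha, b, hb, hab⟩ := hE
    exact ((ih ha).tail hab).trans (Pi0.reach_of_mem _ hb hy)

/-- The precedence relation of `Π₀`: reachability in the contracted graph. -/
instance {A : SMInstance Boy Girl} (p : Shift A → ℝ) (φ : EdgeFlow A) : PartialOrder (Pi0 p φ) where
  le := Relation.ReflTransGen Pi0.Edge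
  le_refl _ := Relation.ReflTransGen.refl
  le_trans _ _ _ h1 h2 := h1.trans h2
  le_antisymm C D h1 h2 := by
    obtain ⟨C, v, rfl⟩ := C
    obtain ⟨D, w, rfl⟩ := D
    have hv : v ∈ φ.component p v := ⟨.refl, .refl⟩
    have hw : w ∈ φ.component p w := ⟨.refl, .refl⟩
    have hvw : φ.Reach p v w := Pi0.reach_of_path h1 hv hw
    have hwv : φ.Reach p w v := Pi0.reach_of_path h2 hw hv
    refine Subtype.ext (Set.ext fun x => ⟨fun h => ?_, fun h => ?_⟩)
    · exact ⟨hwv.trans h.1, h.2.trans hvw⟩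
    · exact ⟨hvw.trans h.1, h.2.trans hwv⟩

/-- The closed sets (closed under predecessors) of `Π₀` that contain the component of the dummy
vertex `s` and do not contain the component of the dummy vertex `t`, with union and intersection. As
`s` precedes and `t` succeeds everything, these are the closed sets other than the empty set and the
whole of `Π₀`. -/
def closedSets {A : SMInstance Boy Girl} (p : Shift A → ℝ) (φ : EdgeFlow A) :
    Sublattice (LowerSet (Pi0 p φ)) where
  carrier := {S | Pi0.of p φ ⊥ ∈ S ∧ Pi0.of p φ ⊤ ∉ S}
  supClosed' := fun _ hS _ hT => ⟨Or.inl hS.1, fun h => h.elim hS.2 hT.2⟩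
  infClosed' := fun _ hS _ hT => ⟨⟨hS.1, hT.1⟩, fun h => hS.2 h.1⟩

/-- The rotations in the union of the components that belong to `S`. -/
def unionOfRotations {A : SMInstance Boy Girl} {p : Shift A → ℝ} {φ : EdgeFlow A}
    (S : LowerSet (Pi0 p φ)) : Set (Rotation A) :=
  {ρ | ∃ C ∈ S, rotVertex ρ ∈ C.1}

end RobustSM

/-! Robust stable matchings are minimum cuts, and the minimum cuts of a network can be read off the
residual graph of any maximum flow.

Lattice side. A stable matching `M` is encoded by `elimSet A M`, the rotations whose pairs it has
passed. Dominance becomes inclusion, meet becomes intersection, join becomes union, and every closed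
set of rotations occurs (`dominates_iff_elimSet_subset`, `exists_elimSet_eq`): this is the Birkhoff
representation. It rests on two facts: passing one pair of a rotation means passing all of them
(`mem_elimSet_iff`), and eliminating a rotation adds that rotation and no other
(`Eliminates.elimSet_eq`). The order of elimination is then irrelevant as long as it respects
precedence (`elimSeq_of_pairwise`).

Error side. A shift can create only one blocking pair, so `M` is lost exactly when the ranks of the
partners of one boy and of one girl both reach a threshold (`exists_mem_lostSet_iff`). The boy's
condition defines a prime filter of the lattice, the girl's the complement of one. A prime filter of
a lattice of closed sets consists of the sets containing one fixed rotation, or is everything or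
nothing; so it is given by a vertex (`exists_vertex_of_primeFilter`). The two vertices are the ends
of the error edge, and `M` is lost iff this edge crosses the cut whose `s`-side consists of `s` and
`elimSet A M`. Summing over the shifts, `probStable` plus cut capacity is constant
(`probStable_add_cutCap`).

Flow side. For a lower set as `s`-side, the flow value is at most the cut capacity, with equality
iff the side is closed under residual predecessors (`cutCap_sub_value`). A maximum flow has no
augmenting path, so a tight cut exists, and the robust matchings are exactly those with a residually
closed side. Such sides are the unions of the proper closed sets of components, and unions and
intersections carry over. -/

namespace RobustSM

/-! ### Ranks, and the lattice of stable matchings -/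

section StableLattice

set_option linter.unusedSectionVars false

variable {Boy Girl : Type*} [DecidableEq Boy] [DecidableEq Girl]

/-- Position of an outcome in `g`'s list; being unmatched comes last. -/
def girlRank (A : SMInstance Boy Girl) (g : Girl) : Option Boy → ℕ
  | none => (A.girlList g).length
  | some b => (A.girlList g).idxOf b

variable {A : SMInstance Boy Girl} {M M' N : Pairing Boy Girl} {b : Boy} {g : Girl}

@[simp] theorem boyRank_some (A : SMInstance Boy Girl) (b : Boy) (g : Girl) :
    boyRank A b (some g) = (A.boyList b).idxOf g := rfl

@[simp] theorem girlRank_some (A : SMInstance Boy Girl) (g : Girl) (b : Boy) :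
    girlRank A g (some b) = (A.girlList g).idxOf b := rfl

theorem forall_girlPrefers_iff (h : b ∈ A.girlList g) (o : Option Boy) :
    (∀ b' ∈ o, A.GirlPrefers g b b') ↔ (A.girlList g).idxOf b < girlRank A g o := by
  cases o with
  | none => simpa [girlRank] using List.idxOf_lt_length_of_mem h
  | some b' => simp [SMInstance.GirlPrefers]

theorem forall_boyPrefers_iff (h : g ∈ A.boyList b) (o : Option Girl) :
    (∀ g' ∈ o, A.BoyPrefers b g g') ↔ (A.boyList b).idxOf g < boyRank A b o := by
  cases o with
  | none => simpa [boyRank] using List.idxOf_lt_length_of_mem h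
  | some b' => simp [SMInstance.BoyPrefers]

theorem blocks_iff : Blocks A M b g ↔ g ∈ A.boyList b ∧
    (A.boyList b).idxOf g < boyRank A b (M b) ∧
      (A.girlList g).idxOf b < girlRank A g (M.symm g) := by
  unfold Blocks
  refine and_congr_right fun h => ?_
  rw [forall_boyPrefers_iff h, forall_girlPrefers_iff ((A.mem_iff b g).1 h)]

theorem boyRank_le_length (A : SMInstance Boy Girl) (b : Boy) (o : Option Girl) :
    boyRank A b o ≤ (A.boyList b).length := by
  cases o with
  | none => exact le_rfl
  | some g => exact List.idxOf_le_length

theorem girlRank_le_length (A : SMInstance Boy Girl) (g : Girl) (o : Option Boy) :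
    girlRank A g o ≤ (A.girlList g).length := by
  cases o with
  | none => exact le_rfl
  | some g => exact List.idxOf_le_length

theorem boyRank_inj {o o' : Option Girl} (ho : ∀ g ∈ o, g ∈ A.boyList b)
    (ho' : ∀ g ∈ o', g ∈ A.boyList b) (h : boyRank A b o = boyRank A b o') : o = o' := by
  rcases o with _ | g <;> rcases o' with _ | g'
  · rfl
  · have := List.idxOf_lt_length_of_mem (ho' g' rfl)
    simp only [boyRank] at h
    omega
  · have := List.idxOf_lt_length_of_mem (ho g rfl)
    simp only [boyRank] at h
    omega
  · exact congrArg some ((List.idxOf_inj (ho g rfl)).1 h)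

theorem girlRank_inj {o o' : Option Boy} (ho : ∀ b ∈ o, b ∈ A.girlList g)
    (ho' : ∀ b ∈ o', b ∈ A.girlList g) (h : girlRank A g o = girlRank A g o') : o = o' := by
  rcases o with _ | b <;> rcases o' with _ | b'
  · rfl
  · have := List.idxOf_lt_length_of_mem (ho' b' rfl)
    simp only [girlRank] at h
    omega
  · have := List.idxOf_lt_length_of_mem (ho b rfl)
    simp only [girlRank] at h
    omega
  · exact congrArg some ((List.idxOf_inj (ho b rfl)).1 h)

theorem symm_eq_some : M.symm g = some b ↔ M b = some g := M.mem_iff_mem (a := b) (b := g)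

theorem Stable.mem_boyList (h : Stable A M) (hb : M b = some g) : g ∈ A.boyList b := h.1 b g hb

theorem Stable.mem_girlList (h : Stable A M) (hb : M b = some g) : b ∈ A.girlList g :=
  (A.mem_iff b g).1 (h.1 b g hb)

theorem Stable.le_or_le (h : Stable A M) (hg : g ∈ A.boyList b) :
    boyRank A b (M b) ≤ (A.boyList b).idxOf g ∨
      girlRank A g (M.symm g) ≤ (A.girlList g).idxOf b := by
  by_contra! hc
  exact h.2 b g (blocks_iff.2 ⟨hg, hc⟩)

theorem stable_of_le_or_le (h : ∀ b g, M b = some g → g ∈ A.boyList b)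
    (h' : ∀ b g, g ∈ A.boyList b → boyRank A b (M b) ≤ (A.boyList b).idxOf g ∨
      girlRank A g (M.symm g) ≤ (A.girlList g).idxOf b) : Stable A M := by
  refine ⟨fun b g hg => h b g hg, fun b g hB => ?_⟩
  rw [blocks_iff] at hB
  have := h' b g hB.1
  omega

theorem Stable.boyRank_eq (hM : Stable A M) (hM' : Stable A M')
    (h : boyRank A b (M b) = boyRank A b (M' b)) : M b = M' b :=
  boyRank_inj (hM.1 b) (hM'.1 b) h

theorem Stable.girlRank_eq (hM : Stable A M) (hM' : Stable A M')
    (h : girlRank A g (M.symm g) = girlRank A g (M'.symm g)) : M.symm g = M'.symm g :=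
  girlRank_inj (fun _ hb => hM.mem_girlList (symm_eq_some.1 hb))
    (fun _ hb => hM'.mem_girlList (symm_eq_some.1 hb)) h

theorem Dominates.antisymm (hM : Stable A M) (hM' : Stable A M') (h : Dominates A M M')
    (h' : Dominates A M' M) : M = M' :=
  PEquiv.ext fun b => hM.boyRank_eq hM' (le_antisymm (h b) (h' b))

theorem Dominates.trans (h : Dominates A M M') (h' : Dominates A M' N) : Dominates A M N :=
  fun b => (h b).trans (h' b)

/-- The pair was together in `M`. If the boy now wants it back, it fails to block `M'` only because
the girl has done at least as well, and a tie would mean that she still has him. -/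
theorem girl_gains_of_boy_loses (hM' : Stable A M') (hM : Stable A M) (hb : M b = some g)
    (h : boyRank A b (M b) < boyRank A b (M' b)) :
    girlRank A g (M'.symm g) < girlRank A g (M.symm g) := by
  have hg := hM.mem_boyList hb
  rw [symm_eq_some.2 hb, girlRank_some]
  rw [hb, boyRank_some] at h
  rcases hM'.le_or_le hg with h1 | h1
  · omega
  refine lt_of_le_of_ne h1 fun h2 => ?_
  rw [← girlRank_some, ← symm_eq_some.2 hb] at h2
  have h3 := hM'.girlRank_eq hM h2
  rw [symm_eq_some.2 hb, symm_eq_some] at h3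
  rw [h3] at h
  simp at h

theorem boy_loses_of_girl_gains (hM' : Stable A M') (hM : Stable A M) (hb : M' b = some g)
    (h : girlRank A g (M'.symm g) < girlRank A g (M.symm g)) :
    boyRank A b (M b) < boyRank A b (M' b) := by
  have hg := hM'.mem_boyList hb
  rw [symm_eq_some.2 hb, girlRank_some] at h
  rw [hb, boyRank_some]
  rcases hM.le_or_le hg with h1 | h1
  · refine lt_of_le_of_ne h1 fun h2 => ?_
    rw [← boyRank_some, ← hb] at h2
    have h3 := hM.boyRank_eq hM' h2
    rw [hb, ← symm_eq_some] at h3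
    rw [h3] at h
    simp at h
  · omega

section Counting

variable [Fintype Boy] [Fintype Girl]

/-- A double count. `M` injects the losing boys into the gaining girls, and `M'.symm` injects the
gaining girls into the losing boys. Both sets are finite, so both injections are onto. This upgrades
the two implications above to equivalences, and shows that a losing boy remains matched. -/
theorem losing_images (hM : Stable A M) (hM' : Stable A M') :
    (Finset.univ.filter fun b => boyRank A b (M b) < boyRank A b (M' b)).image M =
      (Finset.univ.filter fun g => girlRank A g (M'.symm g) < girlRank A g (M.symm g)).image some ∧
    (Finset.univ.filter fun g => girlRank A g (M'.symm g) < girlRank A g (M.symm g)).image M'.symm =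
      (Finset.univ.filter fun b => boyRank A b (M b) < boyRank A b (M' b)).image some := by
  set BL := Finset.univ.filter fun b => boyRank A b (M b) < boyRank A b (M' b) with hBL
  set GG := Finset.univ.filter fun g => girlRank A g (M'.symm g) < girlRank A g (M.symm g) with hGG
  have matched : ∀ b ∈ BL, ∃ g, M b = some g := fun b hb => by
    refine Option.ne_none_iff_exists'.1 fun h => ?_
    have := boyRank_le_length A b (M' b)
    have hb' := (Finset.mem_filter.1 hb).2
    rw [h] at hb'
    exact absurd hb' this.not_gt
  have matched' : ∀ g ∈ GG, ∃ b, M'.symm g = some b := fun g hg => by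
    refine Option.ne_none_iff_exists'.1 fun h => ?_
    have := girlRank_le_length A g (M.symm g)
    have hg' := (Finset.mem_filter.1 hg).2
    rw [h] at hg'
    exact absurd hg' this.not_gt
  have s1 : BL.image M ⊆ GG.image some := by
    intro o ho
    obtain ⟨b, hb, rfl⟩ := Finset.mem_image.1 ho
    obtain ⟨g, hg⟩ := matched b hb
    refine Finset.mem_image.2 ⟨g, ?_, hg.symm⟩
    exact Finset.mem_filter.2 ⟨Finset.mem_univ _,
      girl_gains_of_boy_loses hM' hM hg (Finset.mem_filter.1 hb).2⟩
  have s2 : GG.image M'.symm ⊆ BL.image some := by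
    intro o ho
    obtain ⟨g, hg, rfl⟩ := Finset.mem_image.1 ho
    obtain ⟨b, hb⟩ := matched' g hg
    refine Finset.mem_image.2 ⟨b, ?_, hb.symm⟩
    exact Finset.mem_filter.2 ⟨Finset.mem_univ _,
      boy_loses_of_girl_gains hM' hM (symm_eq_some.1 hb) (Finset.mem_filter.1 hg).2⟩
  have c1 : (BL.image M).card = BL.card := by
    refine Finset.card_image_of_injOn fun b hb b' _ h => ?_
    obtain ⟨g, hg⟩ := matched b hb
    exact M.inj hg (h.symm.trans hg)
  have c2 : (GG.image M'.symm).card = GG.card := by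
    refine Finset.card_image_of_injOn fun g hg g' _ h => ?_
    obtain ⟨b, hb⟩ := matched' g hg
    exact M'.symm.inj hb (h.symm.trans hb)
  have d1 : (GG.image some).card = GG.card :=
    Finset.card_image_of_injective _ (Option.some_injective _)
  have d2 : (BL.image some).card = BL.card :=
    Finset.card_image_of_injective _ (Option.some_injective _)
  have e1 := Finset.card_le_card s1
  have e2 := Finset.card_le_card s2
  exact ⟨Finset.eq_of_subset_of_card_le s1 (by omega), Finset.eq_of_subset_of_card_le s2 (by omega)⟩

theorem boy_loses_iff_girl_gains (hM : Stable A M) (hM' : Stable A M') (hb : M b = some g) :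
    boyRank A b (M b) < boyRank A b (M' b) ↔
      girlRank A g (M'.symm g) < girlRank A g (M.symm g) := by
  refine ⟨girl_gains_of_boy_loses hM' hM hb, fun h => ?_⟩
  have h1 : some g ∈ (Finset.univ.filter fun g =>
      girlRank A g (M'.symm g) < girlRank A g (M.symm g)).image some := by simpa using h
  rw [← (losing_images hM hM').1] at h1
  obtain ⟨b', h2, h3⟩ := Finset.mem_image.1 h1
  rw [M.inj hb h3]
  exact (Finset.mem_filter.1 h2).2

theorem boy_loses_iff_girl_gains' (hM : Stable A M) (hM' : Stable A M') (hb : M' b = some g) :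
    boyRank A b (M b) < boyRank A b (M' b) ↔
      girlRank A g (M'.symm g) < girlRank A g (M.symm g) := by
  refine ⟨fun h => ?_, boy_loses_of_girl_gains hM' hM hb⟩
  have h1 : some b ∈ (Finset.univ.filter fun b =>
      boyRank A b (M b) < boyRank A b (M' b)).image some := by simpa using h
  rw [← (losing_images hM hM').2] at h1
  obtain ⟨g', h2, h3⟩ := Finset.mem_image.1 h1
  have h4 := hb.symm.trans (symm_eq_some.1 h3)
  rw [Option.some.inj h4]
  exact (Finset.mem_filter.1 h2).2

theorem Dominates.girlRank_le (hM : Stable A M) (hM' : Stable A M') (h : Dominates A M M')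
    (g : Girl) : girlRank A g (M'.symm g) ≤ girlRank A g (M.symm g) := by
  by_contra! hc
  rcases hs : M.symm g with _ | b
  · have := girlRank_le_length A g (M'.symm g)
    rw [hs] at hc
    simp only [girlRank] at hc this
    omega
  · have := (boy_loses_iff_girl_gains' hM' hM (symm_eq_some.1 hs)).2 hc
    have := h b
    omega

/-- Giving each boy his better partner is consistent with giving each girl her worse one because,
along a pair, the boy loses exactly when the girl gains. Stability survives: either one of the two
matchings already satisfies the boy, or both satisfy the girl. -/
theorem exists_meet (hM : Stable A M) (hM' : Stable A M') : ∃ N, Stable A N ∧ IsMeet A M M' N ∧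
    (∀ b, boyRank A b (N b) = min (boyRank A b (M b)) (boyRank A b (M' b))) ∧
    ∀ g, girlRank A g (N.symm g) = max (girlRank A g (M.symm g)) (girlRank A g (M'.symm g)) := by
  let N : Pairing Boy Girl :=
    { toFun := fun b => if boyRank A b (M b) ≤ boyRank A b (M' b) then M b else M' b
      invFun := fun g => if girlRank A g (M.symm g) ≤ girlRank A g (M'.symm g) then M'.symm g
        else M.symm g
      inv := fun b g => by
        have k1 := boy_loses_iff_girl_gains (b := b) (g := g) hM hM'
        have k2 := boy_loses_iff_girl_gains' (b := b) (g := g) hM hM'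
        have k3 := boy_loses_iff_girl_gains (b := b) (g := g) hM' hM
        have k4 := boy_loses_iff_girl_gains' (b := b) (g := g) hM' hM
        have k5 := hM.boyRank_eq (b := b) hM'
        have k6 := hM.girlRank_eq (g := g) hM'
        have k7 := symm_eq_some (M := M) (b := b) (g := g)
        have k8 := symm_eq_some (M := M') (b := b) (g := g)
        change (ite _ _ _) = some b ↔ (ite _ _ _) = some g
        grind }
  have hb : ∀ b, N b = if boyRank A b (M b) ≤ boyRank A b (M' b) then M b else M' b :=
    fun _ => rfl
  have hg : ∀ g, N.symm g = if girlRank A g (M.symm g) ≤ girlRank A g (M'.symm g) then M'.symm g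
      else M.symm g := fun _ => rfl
  have rb : ∀ b, boyRank A b (N b) = min (boyRank A b (M b)) (boyRank A b (M' b)) := by grind
  have rg : ∀ g, girlRank A g (N.symm g) =
      max (girlRank A g (M.symm g)) (girlRank A g (M'.symm g)) := by grind
  refine ⟨N, stable_of_le_or_le (fun b g h => ?_) (fun b g h => ?_), hb, rb, rg⟩
  · rw [hb] at h
    split_ifs at h
    · exact hM.mem_boyList h
    · exact hM'.mem_boyList h
  · have h1 := hM.le_or_le h
    have h2 := hM'.le_or_le h
    rw [rb, rg]
    omega

theorem exists_join (hM : Stable A M) (hM' : Stable A M') : ∃ N, Stable A N ∧ IsJoin A M M' N ∧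
    (∀ b, boyRank A b (N b) = max (boyRank A b (M b)) (boyRank A b (M' b))) ∧
    ∀ g, girlRank A g (N.symm g) = min (girlRank A g (M.symm g)) (girlRank A g (M'.symm g)) := by
  let N : Pairing Boy Girl :=
    { toFun := fun b => if boyRank A b (M b) ≤ boyRank A b (M' b) then M' b else M b
      invFun := fun g => if girlRank A g (M.symm g) ≤ girlRank A g (M'.symm g) then M.symm g
        else M'.symm g
      inv := fun b g => by
        have k1 := boy_loses_iff_girl_gains (b := b) (g := g) hM hM'
        have k2 := boy_loses_iff_girl_gains' (b := b) (g := g) hM hM'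
        have k3 := boy_loses_iff_girl_gains (b := b) (g := g) hM' hM
        have k4 := boy_loses_iff_girl_gains' (b := b) (g := g) hM' hM
        have k5 := hM.boyRank_eq (b := b) hM'
        have k6 := hM.girlRank_eq (g := g) hM'
        have k7 := symm_eq_some (M := M) (b := b) (g := g)
        have k8 := symm_eq_some (M := M') (b := b) (g := g)
        change (ite _ _ _) = some b ↔ (ite _ _ _) = some g
        grind }
  have hb : ∀ b, N b = if boyRank A b (M b) ≤ boyRank A b (M' b) then M' b else M b :=
    fun _ => rfl
  have hg : ∀ g, N.symm g = if girlRank A g (M.symm g) ≤ girlRank A g (M'.symm g) then M.symm g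
      else M'.symm g := fun _ => rfl
  have rb : ∀ b, boyRank A b (N b) = max (boyRank A b (M b)) (boyRank A b (M' b)) := by grind
  have rg : ∀ g, girlRank A g (N.symm g) =
      min (girlRank A g (M.symm g)) (girlRank A g (M'.symm g)) := by grind
  refine ⟨N, stable_of_le_or_le (fun b g h => ?_) (fun b g h => ?_), hb, rb, rg⟩
  · rw [hb] at h
    split_ifs at h
    · exact hM'.mem_boyList h
    · exact hM.mem_boyList h
  · have h1 := hM.le_or_le h
    have h2 := hM'.le_or_le h
    rw [rb, rg]
    omega

end Counting

end StableLattice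

/-! ### Existence of stable and boy-optimal matchings -/

section Existence

set_option linter.unusedSectionVars false

variable {Boy Girl : Type*} [DecidableEq Boy] [DecidableEq Girl] [Fintype Boy] [Fintype Girl]

/-- One proposal of deferred acceptance. The invariant is that only unmatched boys are in blocking
pairs; a boy thrown out by the proposal becomes unmatched, so it is preserved, and the girls' total
rank drops. -/
theorem exists_improvement {A : SMInstance Boy Girl} {M : Pairing Boy Girl}
    (hM : ∀ b g, M b = some g → g ∈ A.boyList b) (hfree : ∀ b g, Blocks A M b g → M b = none)
    (hne : ∃ b g, Blocks A M b g) :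
    ∃ N : Pairing Boy Girl, (∀ b g, N b = some g → g ∈ A.boyList b) ∧
      (∀ b g, Blocks A N b g → N b = none) ∧
      ∑ g, girlRank A g (N.symm g) < ∑ g, girlRank A g (M.symm g) := by
  obtain ⟨b, hb⟩ := hne
  obtain ⟨g, hg, hmin⟩ := WellFounded.has_min
    (InvImage.wf (fun g => (A.boyList b).idxOf g) Nat.lt_wfRel.wf) {g | Blocks A M b g} hb
  have hMb := hfree b g hg
  obtain ⟨h1, h2, h3⟩ := blocks_iff.1 hg
  let N : Pairing Boy Girl :=
    { toFun := fun b' => if b' = b then some g else if M b' = some g then none else M b'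
      invFun := fun g' => if g' = g then some b else M.symm g'
      inv := fun b' g' => by
        have k1 := symm_eq_some (M := M) (b := b') (g := g')
        change (ite _ _ _) = some b' ↔ (ite _ _ _) = some g'
        grind }
  have hNb : ∀ b', N b' = if b' = b then some g else if M b' = some g then none else M b' :=
    fun _ => rfl
  have hNg : ∀ g', N.symm g' = if g' = g then some b else M.symm g' := fun _ => rfl
  have rg : ∀ g', girlRank A g' (N.symm g') ≤ girlRank A g' (M.symm g') := fun g' => by
    rw [hNg]
    split_ifs with h
    · subst h
      exact h3.le
    · exact le_rfl
  refine ⟨N, fun b' g' h => ?_, fun b' g' h => ?_, ?_⟩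
  · rw [hNb] at h
    split_ifs at h with k1 k2
    · cases h
      rwa [k1]
    · exact hM _ _ h
  · by_contra hc
    obtain ⟨k1, k2, k3⟩ := blocks_iff.1 h
    have k4 := k3.trans_le (rg g')
    rw [hNb] at k2 hc
    -- The proposer is in no blocking pair afterwards, because `g` was his best blocking girl.
    by_cases hbb : b' = b
    · subst hbb
      rw [if_pos rfl, boyRank_some] at k2
      refine hmin g' (blocks_iff.2 ⟨k1, ?_, k4⟩) k2
      rw [hMb]
      exact List.idxOf_lt_length_of_mem k1
    · rw [if_neg hbb] at k2 hc
      by_cases k5 : M b' = some g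
      · exact hc (if_pos k5)
      rw [if_neg k5] at k2 hc
      exact hc (hfree b' g' (blocks_iff.2 ⟨k1, k2, k4⟩))
  · refine Finset.sum_lt_sum (fun g' _ => rg g') ⟨g, Finset.mem_univ _, ?_⟩
    rw [hNg, if_pos rfl]
    exact h3

theorem exists_stable (A : SMInstance Boy Girl) : ∃ M, Stable A M := by
  obtain ⟨M, ⟨h1, h2⟩, hmin⟩ := WellFounded.has_min
    (InvImage.wf (fun M : Pairing Boy Girl => ∑ g, girlRank A g (M.symm g)) Nat.lt_wfRel.wf)
    {M | (∀ b g, M b = some g → g ∈ A.boyList b) ∧ ∀ b g, Blocks A M b g → M b = none}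
    ⟨⊥, fun b g h => by simp at h, fun b g _ => rfl⟩
  refine ⟨M, h1, fun b g h => ?_⟩
  obtain ⟨N, k1, k2, k3⟩ := exists_improvement h1 h2 ⟨b, g, h⟩
  exact hmin N ⟨k1, k2⟩ k3

/-- Minimise the boys' total rank: if some stable matching were better for one boy, the meet with it
would have a smaller total. -/
theorem exists_isBoyOptimal (A : SMInstance Boy Girl) : ∃ M₀, IsBoyOptimal A M₀ := by
  obtain ⟨M, h1, hmin⟩ := WellFounded.has_min
    (InvImage.wf (fun M : Pairing Boy Girl => ∑ b, boyRank A b (M b)) Nat.lt_wfRel.wf)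
    {M | Stable A M} (exists_stable A)
  refine ⟨M, h1, fun M' h' b => ?_⟩
  by_contra! hc
  obtain ⟨N, k1, -, k2, -⟩ := exists_meet h1 h'
  refine hmin N k1 (Finset.sum_lt_sum (fun b _ => ?_) ⟨b, Finset.mem_univ _, ?_⟩)
  · rw [k2]
    exact min_le_left _ _
  · rw [k2]
    omega

end Existence

/-! ### Cyclic sequences that follow a relation -/

section Cycles

variable {α : Type*} {r : α → α → Prop}

theorem exists_cons_of_mem_cycle {c : Cycle α} {x : α} (h : x ∈ c) :
    ∃ l : List α, c = ((x :: l : List α) : Cycle α) := by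
  induction c using Quotient.inductionOn' with
  | h l =>
    obtain ⟨l₁, l₂, rfl⟩ := List.append_of_mem (Cycle.mem_coe_iff.1 h)
    exact ⟨l₂ ++ l₁, Cycle.coe_eq_coe.2 ⟨l₁.length, by simp⟩⟩

theorem cycle_chain_succ {c : Cycle α} (hc : c.Chain r) {x : α} (h : x ∈ c) :
    ∃ y ∈ c, r x y := by
  obtain ⟨l, rfl⟩ := exists_cons_of_mem_cycle h
  rw [Cycle.chain_coe_cons] at hc
  cases l with
  | nil => exact ⟨x, h, by simpa using hc⟩
  | cons y l => exact ⟨y, by simp, by simpa using (List.isChain_cons_cons.1 hc).1⟩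

theorem cycle_chain_pred {c : Cycle α} (hc : c.Chain r) {x : α} (h : x ∈ c) :
    ∃ y ∈ c, r y x := by
  obtain ⟨l, rfl⟩ := exists_cons_of_mem_cycle h
  rw [Cycle.chain_coe_cons] at hc
  rcases List.eq_nil_or_concat l with rfl | ⟨l, y, rfl⟩
  · exact ⟨x, h, by simpa using hc⟩
  · refine ⟨y, by simp, ?_⟩
    have : List.IsChain r ((x :: l) ++ y :: x :: []) := by simpa using hc
    exact (List.isChain_cons_cons.1 this.right_of_append).1

/-- On `s` each element has at most one successor, so both walks take the same steps until they
return to `x`; since `x` occurs in neither list, neither stops before the other. -/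
theorem list_eq_of_isChain {s : Set α} (hr : ∀ x y z, y ∈ s → z ∈ s → r x y → r x z → y = z)
    {x : α} (hx : x ∈ s) : ∀ {l l' : List α} {y : α}, (∀ z ∈ l, z ∈ s) → (∀ z ∈ l', z ∈ s) →
      x ∉ l → x ∉ l' → List.IsChain r (y :: (l ++ [x])) → List.IsChain r (y :: (l' ++ [x])) → l = l'
  | [], [], _, _, _, _, _, _, _ => rfl
  | [], z :: l', y, _, h', _, hx', h1, h2 => by
    have := hr y x z hx (h' z (by simp)) (List.isChain_cons_cons.1 h1).1
      (List.isChain_cons_cons.1 h2).1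
    simp [this] at hx'
  | z :: l, [], y, h, _, hx', _, h1, h2 => by
    have := hr y x z hx (h z (by simp)) (List.isChain_cons_cons.1 h2).1
      (List.isChain_cons_cons.1 h1).1
    simp [this] at hx'
  | z :: l, z' :: l', y, h, h', k, k', h1, h2 => by
    obtain ⟨a1, a2⟩ := List.isChain_cons_cons.1 h1
    obtain ⟨b1, b2⟩ := List.isChain_cons_cons.1 h2
    obtain rfl := hr y z z' (h z (by simp)) (h' z' (by simp)) a1 b1
    rw [list_eq_of_isChain hr hx (fun w hw => h w (List.mem_cons_of_mem _ hw))
      (fun w hw => h' w (List.mem_cons_of_mem _ hw)) (fun hw => k (List.mem_cons_of_mem _ hw))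
      (fun hw => k' (List.mem_cons_of_mem _ hw)) a2 b2]

theorem cycle_eq_of_chain {s : Set α} (hr : ∀ x y z, y ∈ s → z ∈ s → r x y → r x z → y = z)
    {c c' : Cycle α} (hc : c.Nodup) (hc' : c'.Nodup) (hs : ∀ x ∈ c, x ∈ s) (hs' : ∀ x ∈ c', x ∈ s)
    (h : c.Chain r) (h' : c'.Chain r) {x : α} (hx : x ∈ c) (hx' : x ∈ c') : c = c' := by
  obtain ⟨l, rfl⟩ := exists_cons_of_mem_cycle hx
  obtain ⟨l', rfl⟩ := exists_cons_of_mem_cycle hx'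
  rw [Cycle.nodup_coe_iff, List.nodup_cons] at hc hc'
  rw [Cycle.chain_coe_cons] at h h'
  rw [list_eq_of_isChain hr (hs x hx) (fun z hz => hs z (by simp [hz]))
    (fun z hz => hs' z (by simp [hz])) hc.1 hc'.1 h h']

end Cycles

/-! ### The successor girl `s_M(b)` -/

section SuccessorGirl

set_option linter.unusedSectionVars false

variable {Boy Girl : Type*} [DecidableEq Boy] [DecidableEq Girl]

theorem find?_eq_some_iff_idxOf {α : Type*} [DecidableEq α] {l : List α} (hl : l.Nodup)
    {q : α → Bool} {a : α} : l.find? q = some a ↔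
      a ∈ l ∧ q a = true ∧ ∀ a' ∈ l, l.idxOf a' < l.idxOf a → ¬ q a' = true := by
  rw [List.find?_eq_some_iff_getElem]
  constructor
  · rintro ⟨h1, i, hi, rfl, h2⟩
    refine ⟨List.getElem_mem hi, h1, fun a' ha' hlt => ?_⟩
    rw [hl.idxOf_getElem] at hlt
    have := h2 _ hlt
    simpa [List.getElem_idxOf] using this
  · rintro ⟨h1, h2, h3⟩
    refine ⟨h2, l.idxOf a, List.idxOf_lt_length_of_mem h1, List.getElem_idxOf _, fun j hj => ?_⟩
    have hj' : j < l.length := hj.trans (List.idxOf_lt_length_of_mem h1)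
    have := h3 l[j] (List.getElem_mem hj') (by rwa [hl.idxOf_getElem])
    simpa using this

variable {A : SMInstance Boy Girl} {M N : Pairing Boy Girl} {b : Boy} {g : Girl}

theorem sGirl_eq_some : sGirl A M b = some g ↔ g ∈ A.boyList b ∧
    (A.girlList g).idxOf b < girlRank A g (M.symm g) ∧
      ∀ g' ∈ A.boyList b, (A.boyList b).idxOf g' < (A.boyList b).idxOf g →
        girlRank A g' (M.symm g') ≤ (A.girlList g').idxOf b := by
  classical
  unfold sGirl
  rw [find?_eq_some_iff_idxOf (A.boyList_nodup b)]
  refine and_congr_right fun h => and_congr ?_ (forall₂_congr fun g' hg' => imp_congr_right fun _ => ?_)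
  · rw [decide_eq_true_eq, forall_girlPrefers_iff ((A.mem_iff b g).1 h)]
  · rw [decide_eq_true_eq, forall_girlPrefers_iff ((A.mem_iff b g').1 hg'), not_lt]

theorem exists_sGirl (h : g ∈ A.boyList b)
    (h' : (A.girlList g).idxOf b < girlRank A g (M.symm g)) :
    ∃ g', sGirl A M b = some g' ∧ (A.boyList b).idxOf g' ≤ (A.boyList b).idxOf g := by
  rcases hs : sGirl A M b with _ | g'
  · classical
    have := List.find?_eq_none.1 hs g h
    rw [decide_eq_true_eq, forall_girlPrefers_iff ((A.mem_iff b g).1 h)] at this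
    exact absurd h' this
  · refine ⟨g', rfl, ?_⟩
    by_contra! hc
    have := (sGirl_eq_some.1 hs).2.2 g h hc
    omega

/-- A girl who would welcome `b` and whom he liked better than his partner would block with him, so
`s_M(b)` comes after the partner. -/
theorem Stable.lt_sGirl (hM : Stable A M) (h : sGirl A M b = some g) :
    boyRank A b (M b) < (A.boyList b).idxOf g := by
  obtain ⟨h1, h2, -⟩ := sGirl_eq_some.1 h
  rcases hM.le_or_le h1 with h3 | h3
  · refine lt_of_le_of_ne h3 fun h4 => ?_
    rw [← boyRank_some] at h4
    have h5 := boyRank_inj (hM.1 b) (by rintro _ ⟨⟩; exact h1) h4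
    rw [symm_eq_some.2 h5] at h2
    simp at h2
  · omega

/-- Two exposed rotations that share a pair coincide. -/
theorem Exposed.eq_of_mem {ρ σ : Cycle (Boy × Girl)} (hρ : Exposed A M ρ) (hσ : Exposed A M σ)
    {q : Boy × Girl} (h : q ∈ ρ) (h' : q ∈ σ) : ρ = σ := by
  refine cycle_eq_of_chain (s := {q : Boy × Girl | M q.1 = some q.2}) ?_ hρ.1 hσ.1 hρ.2.2.1 hσ.2.2.1 hρ.2.2.2
    hσ.2.2.2 h h'
  rintro x ⟨y1, y2⟩ ⟨z1, z2⟩ hy hz h1 h2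
  have h3 : y2 = z2 := Option.some.inj (h1.symm.trans h2)
  subst h3
  exact Prod.ext (M.inj hy hz) rfl

end SuccessorGirl

theorem cycle_nodup_map {α β : Type*} {f : α → β} (hf : Function.Injective f) {c : Cycle α}
    (h : c.Nodup) : (c.map f).Nodup := by
  induction c using Quotient.inductionOn' with
  | h l => exact List.Nodup.map hf h

/-! ### Elimination of rotations -/

section Elimination

set_option linter.unusedSectionVars false

variable {Boy Girl : Type*} [DecidableEq Boy] [DecidableEq Girl]
  {A : SMInstance Boy Girl} {M M' N : Pairing Boy Girl} {b : Boy} {g : Girl}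

theorem exists_pairing (f : Boy → Option Girl)
    (hf : ∀ b b' g, f b = some g → f b' = some g → b = b') : ∃ N : Pairing Boy Girl, ∀ b, N b = f b := by
  classical
  refine ⟨{ toFun := f, invFun := fun g => if h : ∃ b, f b = some g then some h.choose else none,
            inv := fun b g => ?_ }, fun _ => rfl⟩
  constructor
  · intro h
    split_ifs at h with k
    rw [← Option.some.inj h]
    exact k.choose_spec
  · intro h
    have k : ∃ b, f b = some g := ⟨b, h⟩
    rw [dif_pos k, hf _ _ _ k.choose_spec h]

/-- Every girl weakly gains. A boy who moves skips only girls who, by the definition of `s_M`, do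
not prefer him to their partner, so no new blocking pair arises. -/
theorem Eliminates.stable {ρ : Rotation A} (hM : Stable A M) (h : Eliminates A M ρ N) :
    Stable A N ∧ Dominates A M N := by
  obtain ⟨⟨-, -, h1, h2⟩, h3, h4⟩ := h
  have rot : ∀ b, (∃ g', sGirl A M b = some g' ∧ N b = some g') ∨ N b = M b := fun b => by
    by_cases hb : ∃ g, (b, g) ∈ ρ.1
    · obtain ⟨g, hg⟩ := hb
      obtain ⟨q', -, k⟩ := cycle_chain_succ h2 hg
      exact Or.inl ⟨q'.2, k, (h3 _ hg).trans k⟩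
    · exact Or.inr (h4 b (not_exists.1 hb))
  have rb : Dominates A M N := fun b => by
    rcases rot b with ⟨g', k1, k2⟩ | k
    · rw [k2]
      exact (hM.lt_sGirl k1).le
    · rw [k]
  have rg : ∀ g, girlRank A g (N.symm g) ≤ girlRank A g (M.symm g) := fun g => by
    rcases hs : M.symm g with _ | b
    · exact girlRank_le_length A g _
    have hb := symm_eq_some.1 hs
    by_cases hbρ : ∃ g', (b, g') ∈ ρ.1
    · obtain ⟨g', hg'⟩ := hbρ
      obtain rfl : g' = g := Option.some.inj ((h1 _ hg').symm.trans hb)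
      obtain ⟨q, k1, k2⟩ := cycle_chain_pred h2 hg'
      have k3 := symm_eq_some.2 ((h3 q k1).trans k2)
      have k4 := (sGirl_eq_some.1 k2).2.1
      simp only at k3 k4
      rw [hs] at k4
      rw [k3]
      exact k4.le
    · rw [symm_eq_some.2 ((h4 b (not_exists.1 hbρ)).trans hb)]
  refine ⟨stable_of_le_or_le (fun b g hb => ?_) (fun b g hg => ?_), rb⟩
  · rcases rot b with ⟨g', k1, k2⟩ | k
    · obtain rfl := Option.some.inj (k2.symm.trans hb)
      exact (sGirl_eq_some.1 k1).1
    · exact hM.mem_boyList (k.symm.trans hb)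
  · have h5 := rg g
    have h6 := hM.le_or_le hg
    rcases rot b with ⟨g', k1, k2⟩ | k
    · have h7 := (sGirl_eq_some.1 k1).2.2 g hg
      rw [k2, boyRank_some]
      omega
    · rw [k]
      omega

theorem exists_eliminates [Finite Boy] [Finite Girl] {ρ : Rotation A} (h : Exposed A M ρ.1) :
    ∃ N, Eliminates A M ρ N := by
  classical
  obtain ⟨-, -, h1, h2⟩ := id h
  choose f hf hf' using fun q : {q // q ∈ ρ.1} => cycle_chain_succ h2 q.2
  -- Every pair has a predecessor on the cycle, so the successor map is onto; by finiteness it is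
  -- injective, and no two boys of the rotation move to the same girl.
  have hsurj : Function.Surjective (fun q => (⟨f q, hf q⟩ : {q // q ∈ ρ.1})) := fun q => by
    obtain ⟨q', k1, k2⟩ := cycle_chain_pred h2 q.2
    refine ⟨⟨q', k1⟩, Subtype.ext ?_⟩
    have k3 := Option.some.inj ((hf' ⟨q', k1⟩).symm.trans k2)
    refine Prod.ext (M.inj (h1 _ (hf _)) ?_) k3
    rw [k3]
    exact h1 _ q.2
  have hinj := Finite.injective_iff_surjective.2 hsurj
  obtain ⟨N, hN⟩ := exists_pairing (fun b => if ∃ g, (b, g) ∈ ρ.1 then sGirl A M b else M b) (by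
    have key : ∀ b b' g, (∃ g, (b, g) ∈ ρ.1) → (¬ ∃ g, (b', g) ∈ ρ.1) → sGirl A M b = some g →
        M b' = some g → False := by
      rintro b b' g ⟨g₁, k⟩ k' e e'
      have k1 := Option.some.inj ((hf' ⟨_, k⟩).symm.trans e)
      have k2 := h1 _ (hf ⟨_, k⟩)
      rw [k1] at k2
      refine k' ⟨g, ?_⟩
      rw [← M.inj k2 e', ← k1]
      exact hf _
    intro b b' g e e'
    split_ifs at e e' with k k' k'
    · obtain ⟨g₁, k⟩ := k
      obtain ⟨g₂, k'⟩ := k'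
      have k1 := Option.some.inj ((hf' ⟨_, k⟩).symm.trans e)
      have k2 := Option.some.inj ((hf' ⟨_, k'⟩).symm.trans e')
      have k3 : f ⟨_, k⟩ = f ⟨_, k'⟩ := by
        refine Prod.ext (M.inj (h1 _ (hf _)) ?_) (k1.trans k2.symm)
        rw [k1.trans k2.symm]
        exact h1 _ (hf _)
      have k4 := hinj (a₁ := ⟨_, k⟩) (a₂ := ⟨_, k'⟩) (Subtype.ext k3)
      exact congrArg (fun q => q.1.1) k4
    · exact (key _ _ _ k k' e e').elim
    · exact (key _ _ _ k' k e' e).elim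
    · exact M.inj e e')
  refine ⟨N, h, fun q hq => ?_, fun b hb => ?_⟩
  · rw [hN, if_pos ⟨q.2, hq⟩]
  · rw [hN, if_neg (not_exists.2 hb)]

section Losing

variable [Fintype Boy] [Fintype Girl]

theorem exists_partner_of_loses (hM : Stable A M) (hN : Stable A N)
    (h : boyRank A b (M b) < boyRank A b (N b)) :
    ∃ g, N b = some g ∧ girlRank A g (N.symm g) < girlRank A g (M.symm g) := by
  have h1 : some b ∈ (Finset.univ.filter fun b =>
      boyRank A b (M b) < boyRank A b (N b)).image some := by simpa using h
  rw [← (losing_images hM hN).2] at h1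
  obtain ⟨g, h2, h3⟩ := Finset.mem_image.1 h1
  exact ⟨g, symm_eq_some.1 h3, (Finset.mem_filter.1 h2).2⟩

theorem exists_partner_of_gains (hM : Stable A M) (hN : Stable A N)
    (h : girlRank A g (N.symm g) < girlRank A g (M.symm g)) :
    ∃ b, M b = some g ∧ boyRank A b (M b) < boyRank A b (N b) := by
  have h1 : some g ∈ (Finset.univ.filter fun g =>
      girlRank A g (N.symm g) < girlRank A g (M.symm g)).image some := by simpa using h
  rw [← (losing_images hM hN).1] at h1
  obtain ⟨b, h2, h3⟩ := Finset.mem_image.1 h1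
  exact ⟨b, h3, (Finset.mem_filter.1 h2).2⟩

/-- The losing boys are closed under passing to the `M`-partner of the successor girl. The
`N`-partner of `b` would already have welcomed him in `M`, so `s_M(b)` is at or above her; and
`s_M(b)` gains too, since otherwise she and `b` would block `N`. -/
theorem exists_sGirl_of_loses (hM : Stable A M) (hN : Stable A N)
    (h : boyRank A b (M b) < boyRank A b (N b)) :
    ∃ b' g', sGirl A M b = some g' ∧ (A.boyList b).idxOf g' ≤ boyRank A b (N b) ∧
      M b' = some g' ∧ boyRank A b' (M b') < boyRank A b' (N b') := by
  obtain ⟨g, hg, hgain⟩ := exists_partner_of_loses hM hN h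
  have hgb := hN.mem_boyList hg
  have hlt : (A.girlList g).idxOf b < girlRank A g (M.symm g) := by
    rwa [symm_eq_some.2 hg] at hgain
  obtain ⟨g', h1, h2⟩ := exists_sGirl hgb hlt
  obtain ⟨h3, h4, -⟩ := sGirl_eq_some.1 h1
  have hgain' : girlRank A g' (N.symm g') < girlRank A g' (M.symm g') := by
    rcases hN.le_or_le h3 with h5 | h5
    · rw [hg, boyRank_some] at h5
      rwa [(List.idxOf_inj h3).1 (le_antisymm h2 h5)]
    · omega
  obtain ⟨b', h6, h7⟩ := exists_partner_of_gains hM hN hgain'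
  refine ⟨b', g', h1, ?_, h6, h7⟩
  rw [hg]
  exact h2

/-- Between two different comparable stable matchings there is an elimination. -/
theorem exists_eliminates_of_dominates (hM : Stable A M) (hN : Stable A N) (h : Dominates A M N)
    (hne : M ≠ N) : ∃ ρ M', Eliminates A M ρ M' ∧ Dominates A M' N := by
  classical
  let D := {q : Boy × Girl // M q.1 = some q.2 ∧ boyRank A q.1 (M q.1) < boyRank A q.1 (N q.1)}
  have next : ∀ q : D, ∃ q' : D, sGirl A M q.1.1 = some q'.1.2 ∧
      (A.boyList q.1.1).idxOf q'.1.2 ≤ boyRank A q.1.1 (N q.1.1) := fun q => by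
    obtain ⟨b', g', h1, h2, h3⟩ := exists_sGirl_of_loses hM hN q.2.2
    exact ⟨⟨(b', g'), h3⟩, h1, h2⟩
  choose f hf hf' using next
  obtain ⟨d⟩ : Nonempty D := by
    have : ∃ b, boyRank A b (M b) < boyRank A b (N b) := by
      by_contra! hc
      exact hne (h.antisymm hM hN hc)
    obtain ⟨b, hb⟩ := this
    rcases hs : M b with _ | g
    · have := boyRank_le_length A b (N b)
      rw [hs] at hb
      exact absurd hb this.not_gt
    · exact ⟨⟨(b, g), hs, hb⟩⟩
  -- The successor map on the finite set of losing pairs has a periodic point, whose orbit is the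
  -- exposed rotation. No boy on it overshoots his `N`-partner, by `hf'`.
  obtain ⟨x, hx⟩ : ∃ x, x ∈ Function.periodicPts f := by
    obtain ⟨m, n, hmn, he⟩ := Finite.exists_ne_map_eq_of_infinite (fun n => f^[n] d)
    wlog hlt : m < n generalizing m n
    · exact this n m hmn.symm he.symm (by omega)
    refine ⟨f^[m] d, n - m, by omega, ?_⟩
    rw [Function.IsPeriodicPt, Function.IsFixedPt, ← Function.iterate_add_apply]
    rw [Nat.sub_add_cancel hlt.le]
    exact he.symm
  let c : Cycle (Boy × Girl) := (Function.periodicOrbit f x).map Subtype.val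
  have hmem : ∀ q ∈ c, ∃ d : D, d.1 = q := fun q hq => by
    obtain ⟨d, -, hd⟩ := Cycle.mem_map.1 hq
    exact ⟨d, hd⟩
  have hexp : Exposed A M c := by
    refine ⟨cycle_nodup_map Subtype.val_injective Function.nodup_periodicOrbit, ?_,
      fun q hq => ?_, ?_⟩
    · intro hc
      have h1 : x.1 ∈ c := Cycle.mem_map.2 ⟨x, Function.self_mem_periodicOrbit hx, rfl⟩
      rw [hc] at h1
      exact Cycle.notMem_nil _ h1
    · obtain ⟨d, rfl⟩ := hmem q hq
      exact d.2.1
    · rw [Cycle.chain_map, Function.periodicOrbit_chain' _ hx]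
      intro n
      rw [Function.iterate_succ_apply']
      exact hf _
  let ρ : Rotation A := ⟨c, M, hM, hexp⟩
  obtain ⟨M', hM'⟩ := exists_eliminates (ρ := ρ) hexp
  refine ⟨ρ, M', hM', fun b => ?_⟩
  by_cases hb : ∃ g, (b, g) ∈ c
  · obtain ⟨g, hg⟩ := hb
    obtain ⟨d, hd⟩ := hmem _ hg
    rw [hM'.2.1 _ hg]
    have h1 := hf d
    have h2 := hf' d
    rw [hd] at h1 h2
    simp only at h1 h2 ⊢
    rw [h1]
    exact h2
  · rw [hM'.2.2 b (not_exists.1 hb)]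
    exact h b

end Losing

end Elimination

/-! ### Propagating a property backwards round a cycle -/

section Backward

variable {α : Type*} {r : α → α → Prop}

theorem list_backward {s : Set α} {P : α → Prop}
    (H : ∀ x y, x ∈ s → y ∈ s → r x y → P y → P x) {x : α} (hx : x ∈ s) (hP : P x) :
    ∀ {l : List α} {y : α}, (∀ z ∈ y :: l, z ∈ s) → List.IsChain r (y :: (l ++ [x])) →
      ∀ z ∈ y :: l, P z
  | [], y, h, hc, z, hz => by
    obtain rfl : z = y := by simpa using hz
    exact H z x (h z hz) hx (List.isChain_cons_cons.1 hc).1 hP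
  | w :: l, y, h, hc, z, hz => by
    obtain ⟨h1, h2⟩ := List.isChain_cons_cons.1 hc
    have ih := list_backward H hx hP (fun z hz => h z (List.mem_cons_of_mem _ hz)) h2
    rcases List.mem_cons.1 hz with rfl | hz
    · exact H z w (h z (by simp)) (h w (by simp)) h1 (ih w (by simp))
    · exact ih z hz

theorem cycle_backward {c : Cycle α} {P : α → Prop} (hc : c.Chain r)
    (H : ∀ x y, x ∈ c → y ∈ c → r x y → P y → P x) {x : α} (hx : x ∈ c) (hP : P x) :
    ∀ z ∈ c, P z := by
  intro z hz
  obtain ⟨l, hl⟩ := exists_cons_of_mem_cycle hx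
  have hmem : ∀ z, z ∈ c ↔ z ∈ x :: l := fun z => by rw [hl, Cycle.mem_coe_iff]
  rw [hl, Cycle.chain_coe_cons] at hc
  exact list_backward (s := {z | z ∈ c}) H hx hP (fun z hz => (hmem z).2 hz) hc z ((hmem z).1 hz)

end Backward

/-! ### Stable matchings as closed sets of rotations -/

section Rotations

set_option linter.unusedSectionVars false

variable {Boy Girl : Type*} [DecidableEq Boy] [DecidableEq Girl] [Fintype Boy] [Fintype Girl]
  {A : SMInstance Boy Girl} {M M' N K : Pairing Boy Girl} {b : Boy} {g : Girl}

/-- If one pair of a rotation exposed in `M` survives in a later stable matching, they all do. -/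
theorem Exposed.pairs_persist {ρ : Cycle (Boy × Girl)} (hM : Stable A M) (hK : Stable A K)
    (h : Dominates A M K) (hρ : Exposed A M ρ) {q : Boy × Girl} (hq : q ∈ ρ)
    (hKq : K q.1 = some q.2) : ∀ q ∈ ρ, K q.1 = some q.2 := by
  obtain ⟨-, -, h1, h2⟩ := hρ
  refine cycle_backward h2 ?_ hq hKq
  rintro ⟨b, g'⟩ ⟨b₁, g⟩ hb hb₁ hs hKb₁
  have hMb := h1 _ hb
  have hMb₁ := h1 _ hb₁
  simp only at hs hKb₁ hMb hMb₁ ⊢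
  obtain ⟨k1, k2, k3⟩ := sGirl_eq_some.1 hs
  -- If `b` has moved while `g = s_M(b)` still has her `M`-partner, she prefers `b`, so stability of
  -- `K` puts his new partner at or above `g`. It is not `g`, who is taken; a girl above `g` does
  -- not prefer `b` to her `M`-partner, yet his new partner gained by taking him.
  by_contra hne
  have hlt : boyRank A b (M b) < boyRank A b (K b) := by
    refine lt_of_le_of_ne (h b) fun he => hne ?_
    rw [← hM.boyRank_eq hK he, hMb]
  rw [symm_eq_some.2 hMb₁, ← symm_eq_some.2 hKb₁] at k2
  have k4 : boyRank A b (K b) ≤ (A.boyList b).idxOf g := by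
    have := hK.le_or_le k1
    omega
  obtain ⟨g₂, k5, k6⟩ := exists_partner_of_loses hM hK hlt
  rw [k5, boyRank_some] at k4
  rcases k4.eq_or_lt with k7 | k7
  · obtain rfl := (List.idxOf_inj (hK.mem_boyList k5)).1 k7
    have : b = b₁ := K.inj k5 hKb₁
    subst this
    rw [hMb₁, hKb₁] at hlt
    exact lt_irrefl _ hlt
  · have k8 := k3 g₂ (hK.mem_boyList k5) k7
    rw [symm_eq_some.2 k5, girlRank_some] at k6
    omega

/-- With all pairs in place the successor girls do not change: each keeps her partner, and the girls
skipped before her have only become harder to win. -/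
theorem Exposed.persist {ρ : Cycle (Boy × Girl)} (hM : Stable A M) (hK : Stable A K)
    (h : Dominates A M K) (hρ : Exposed A M ρ) {q : Boy × Girl} (hq : q ∈ ρ)
    (hKq : K q.1 = some q.2) : Exposed A K ρ := by
  have hpairs := hρ.pairs_persist hM hK h hq hKq
  obtain ⟨h1, h2, h3, h4⟩ := hρ
  refine ⟨h1, h2, hpairs, ?_⟩
  have hchain : ρ.Chain (fun q q' => M q'.1 = some q'.2 ∧ K q'.1 = some q'.2 ∧
      sGirl A M q.1 = some q'.2) := by
    obtain ⟨l, hl⟩ := exists_cons_of_mem_cycle hq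
    have hmem : ∀ z, z ∈ q :: l → z ∈ ρ := fun z hz => by rwa [hl, Cycle.mem_coe_iff]
    rw [hl, Cycle.chain_coe_cons] at h4 ⊢
    refine List.IsChain.imp_of_mem_imp (fun x y _ hy hxy => ?_) h4
    have hy' : y ∈ ρ := hmem y (by
      simp only [List.mem_cons, List.mem_append, List.not_mem_nil, or_false] at hy ⊢
      tauto)
    exact ⟨h3 y hy', hpairs y hy', hxy⟩
  refine hchain.imp ?_
  rintro q q' ⟨k1, k2, k3⟩
  obtain ⟨k4, k5, k6⟩ := sGirl_eq_some.1 k3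
  refine sGirl_eq_some.2 ⟨k4, ?_, fun g' hg' hlt => ?_⟩
  · rwa [symm_eq_some.2 k2, ← symm_eq_some.2 k1]
  · exact (h.girlRank_le hM hK g').trans (k6 g' hg' hlt)

/-- In the join of two matchings exposing `ρ` and `σ` the common pair survives. So both rotations
are exposed there, and in one matching a pair determines its rotation. -/
theorem Rotation.eq_of_mem {ρ σ : Rotation A} {q : Boy × Girl} (h : q ∈ ρ.1) (h' : q ∈ σ.1) :
    ρ = σ := by
  obtain ⟨M, hM, hρ⟩ := ρ.2
  obtain ⟨M', hM', hσ⟩ := σ.2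
  obtain ⟨K, hK, -, hr, -⟩ := exists_join hM hM'
  have e : boyRank A q.1 (M q.1) = boyRank A q.1 (M' q.1) := by
    rw [hρ.2.2.1 q h, hσ.2.2.1 q h']
  have hKq : K q.1 = some q.2 := by
    rw [← hρ.2.2.1 q h]
    refine hK.boyRank_eq hM ?_
    rw [hr, ← e, max_self]
  have d1 : Dominates A M K := fun b => (le_max_left _ _).trans (hr b).ge
  have d2 : Dominates A M' K := fun b => (le_max_right _ _).trans (hr b).ge
  exact Subtype.ext ((hρ.persist hM hK d1 h hKq).eq_of_mem (hσ.persist hM' hK d2 h' hKq) h h')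

theorem Rotation.exists_mem (ρ : Rotation A) : ∃ q, q ∈ ρ.1 := by
  obtain ⟨M, -, -, h, -⟩ := ρ.2
  by_contra! hc
  refine h ?_
  induction hρ : ρ.1 using Cycle.induction_on with
  | nil => rfl
  | cons a l _ => exact absurd (by simp [hρ]) (hc a)

/-- The rotations eliminated on the way to `M`: those whose pairs `M` has passed. -/
def elimSet (A : SMInstance Boy Girl) (M : Pairing Boy Girl) : Set (Rotation A) :=
  {ρ | ∃ q ∈ ρ.1, (A.boyList q.1).idxOf q.2 < boyRank A q.1 (M q.1)}

/-- All or nothing: a pair that `M` has not passed survives in the join of `M` with a matching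
exposing `ρ`. Then all pairs survive there, and `M` has passed none. -/
theorem mem_elimSet_iff (hM : Stable A M) {ρ : Rotation A} : ρ ∈ elimSet A M ↔
    ∀ q ∈ ρ.1, (A.boyList q.1).idxOf q.2 < boyRank A q.1 (M q.1) := by
  constructor
  · rintro ⟨q₀, hq₀, hlt⟩ q hq
    by_contra! hc
    obtain ⟨M', hM', hρ⟩ := ρ.2
    obtain ⟨K, hK, -, hr, -⟩ := exists_join hM' hM
    have d : Dominates A M' K := fun b => (le_max_left _ _).trans (hr b).ge
    have hKq : K q.1 = some q.2 := by
      rw [← hρ.2.2.1 q hq]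
      refine hK.boyRank_eq hM' ?_
      rw [hr, hρ.2.2.1 q hq, boyRank_some]
      omega
    have := hρ.pairs_persist hM' hK d hq hKq q₀ hq₀
    have h2 := hr q₀.1
    rw [this, boyRank_some] at h2
    omega
  · intro h
    obtain ⟨q, hq⟩ := ρ.exists_mem
    exact ⟨q, hq, h q hq⟩

theorem elimSet_mono (h : Dominates A M N) : elimSet A M ⊆ elimSet A N := by
  rintro ρ ⟨q, hq, hlt⟩
  exact ⟨q, hq, hlt.trans_le (h q.1)⟩

theorem Exposed.notMem_elimSet {ρ : Rotation A} (h : Exposed A M ρ.1) : ρ ∉ elimSet A M := by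
  rintro ⟨q, hq, hlt⟩
  rw [h.2.2.1 q hq, boyRank_some] at hlt
  exact lt_irrefl _ hlt

/-- Suppose another rotation were passed. Then one of its girls lies strictly between the old and
the new partner of some `b`, and the join of `M` with a matching exposing that rotation marries her
to `b`. She would thereby gain, but the definition of `s_M(b)` says that the skipped girls do not
prefer `b`. -/
theorem Eliminates.elimSet_eq {σ : Rotation A} (hM : Stable A M) (h : Eliminates A M σ N) :
    elimSet A N = insert σ (elimSet A M) := by
  obtain ⟨hN, hMN⟩ := h.stable hM
  refine Set.Subset.antisymm ?_ (Set.insert_subset ?_ (elimSet_mono hMN))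
  · intro ρ hρN
    by_cases hρM : ρ ∈ elimSet A M
    · exact Or.inr hρM
    obtain ⟨q, hq, hlt⟩ := hρN
    have hle : boyRank A q.1 (M q.1) ≤ (A.boyList q.1).idxOf q.2 := by
      by_contra! hc
      exact hρM ⟨q, hq, hc⟩
    by_cases hσ : ∃ g, (q.1, g) ∈ σ.1
    swap
    · rw [h.2.2 q.1 (not_exists.1 hσ)] at hlt
      omega
    obtain ⟨g, hg⟩ := hσ
    obtain ⟨q', -, hs⟩ := cycle_chain_succ h.1.2.2.2 hg
    simp only at hs
    have hNq := h.2.1 _ hg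
    simp only at hNq
    rw [hNq, hs, boyRank_some] at hlt
    have hMq := h.1.2.2.1 _ hg
    simp only at hMq
    rw [hMq, boyRank_some] at hle
    rcases hle.eq_or_lt with he | hlt'
    · have : g = q.2 := (List.idxOf_inj (hM.mem_boyList hMq)).1 he
      subst this
      exact Or.inl (Rotation.eq_of_mem hq hg)
    exfalso
    obtain ⟨M', hM', hρ⟩ := ρ.2
    obtain ⟨K, hK, -, hr, -⟩ := exists_join hM hM'
    have d : Dominates A M K := fun b => (le_max_left _ _).trans (hr b).ge
    have hM'q := hρ.2.2.1 q hq
    have hKq : K q.1 = some q.2 := by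
      rw [← hM'q]
      refine hK.boyRank_eq hM' ?_
      rw [hr, hM'q, hMq, boyRank_some, boyRank_some]
      omega
    have h1 := (sGirl_eq_some.1 hs).2.2 q.2 (hK.mem_boyList hKq) hlt
    have h2 : boyRank A q.1 (M q.1) < boyRank A q.1 (K q.1) := by
      rwa [hMq, hKq]
    have h3 := (boy_loses_iff_girl_gains' hM hK hKq).1 h2
    rw [symm_eq_some.2 hKq, girlRank_some] at h3
    omega
  · obtain ⟨q, hq⟩ := σ.exists_mem
    obtain ⟨q', -, hs⟩ := cycle_chain_succ h.1.2.2.2 hq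
    have h1 := hM.lt_sGirl hs
    refine ⟨q, hq, ?_⟩
    rw [h.1.2.2.1 q hq, boyRank_some] at h1
    rwa [h.2.1 q hq, hs]

theorem ElimSeq.spec : ∀ {l : List (Rotation A)} {M N : Pairing Boy Girl}, Stable A M →
    ElimSeq A M l N → Stable A N ∧ Dominates A M N ∧ (∀ ρ, ρ ∈ elimSet A N ↔ ρ ∈ l ∨ ρ ∈ elimSet A M) ∧
      l.Nodup ∧ ∀ ρ ∈ l, ρ ∉ elimSet A M
  | [], M, N, hM, h => by
    obtain rfl : M = N := h
    exact ⟨hM, fun _ => le_rfl, by simp, by simp, by simp⟩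
  | ρ :: l, M, N, hM, h => by
    obtain ⟨M', h1, h2⟩ := h
    obtain ⟨h3, h4⟩ := h1.stable hM
    obtain ⟨k1, k2, k3, k4, k5⟩ := ElimSeq.spec h3 h2
    have h5 := h1.elimSet_eq hM
    refine ⟨k1, h4.trans k2, fun σ => ?_, ?_, fun σ hσ => ?_⟩
    · rw [k3, h5, List.mem_cons, Set.mem_insert_iff]
      tauto
    · rw [List.nodup_cons]
      refine ⟨fun hρ => k5 ρ hρ ?_, k4⟩
      rw [h5]
      exact Or.inl rfl
    · rcases List.mem_cons.1 hσ with rfl | hσ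
      · exact h1.1.notMem_elimSet
      · exact fun hc => k5 σ hσ (elimSet_mono h4 hc)

theorem exists_elimSeq (hM : Stable A M) (hN : Stable A N) (h : Dominates A M N) :
    ∃ l, ElimSeq A M l N := by
  induction hn : (elimSet A N \ elimSet A M).ncard using Nat.strong_induction_on generalizing M with
  | _ n ih =>
    by_cases hne : M = N
    · exact ⟨[], hne⟩
    obtain ⟨ρ, M', h1, h2⟩ := exists_eliminates_of_dominates hM hN h hne
    have h3 := h1.elimSet_eq hM
    have h4 := (h1.stable hM).1
    have h5 : ρ ∈ elimSet A N := elimSet_mono h2 (h3 ▸ Set.mem_insert _ _)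
    obtain ⟨l, hl⟩ := ih (elimSet A N \ elimSet A M').ncard (by
      rw [← hn]
      refine Set.ncard_lt_ncard ?_ (Set.toFinite _)
      refine (Set.ssubset_iff_of_subset ?_).2 ⟨ρ, ⟨h5, h1.1.notMem_elimSet⟩, fun hc => hc.2 ?_⟩
      · rw [h3]
        exact Set.sdiff_subset_sdiff_right (Set.subset_insert _ _)
      · rw [h3]
        exact Set.mem_insert _ _) h4 h2 rfl
    exact ⟨ρ :: l, M', h1, hl⟩

/-- Joins use the form of `elimSet` with some pair passed; meets, below, use the form with all pairs
passed. -/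
theorem mem_elimSet_of_max (h : ∀ b, boyRank A b (K b) = max (boyRank A b (M b)) (boyRank A b (N b))) :
    elimSet A K = elimSet A M ∪ elimSet A N := by
  ext ρ
  constructor
  · rintro ⟨q, hq, hlt⟩
    rw [h, lt_max_iff] at hlt
    exact hlt.imp (fun k => ⟨q, hq, k⟩) (fun k => ⟨q, hq, k⟩)
  · rintro (⟨q, hq, hlt⟩ | ⟨q, hq, hlt⟩)
    · exact ⟨q, hq, by rw [h]; exact lt_max_of_lt_left hlt⟩
    · exact ⟨q, hq, by rw [h]; exact lt_max_of_lt_right hlt⟩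

theorem mem_elimSet_of_min (hM : Stable A M) (hN : Stable A N) (hK : Stable A K)
    (h : ∀ b, boyRank A b (K b) = min (boyRank A b (M b)) (boyRank A b (N b))) :
    elimSet A K = elimSet A M ∩ elimSet A N := by
  ext ρ
  simp only [Set.mem_inter_iff, mem_elimSet_iff hM, mem_elimSet_iff hN, mem_elimSet_iff hK, h,
    lt_min_iff]
  exact ⟨fun k => ⟨fun q hq => (k q hq).1, fun q hq => (k q hq).2⟩,
    fun k q hq => ⟨k.1 q hq, k.2 q hq⟩⟩

/-- When the sets are nested, `N` and the join have the same set. Eliminating from `N` up to the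
join would add rotations, so the elimination sequence is empty and the join is `N`. -/
theorem dominates_iff_elimSet_subset (hM : Stable A M) (hN : Stable A N) :
    Dominates A M N ↔ elimSet A M ⊆ elimSet A N := by
  refine ⟨elimSet_mono, fun h => ?_⟩
  obtain ⟨K, hK, -, hr, -⟩ := exists_join hM hN
  have d1 : Dominates A M K := fun b => (le_max_left _ _).trans (hr b).ge
  have d2 : Dominates A N K := fun b => (le_max_right _ _).trans (hr b).ge
  obtain ⟨l, hl⟩ := exists_elimSeq hN hK d2
  obtain ⟨-, -, k1, -, k2⟩ := hl.spec hN
  have : l = [] := by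
    refine List.eq_nil_iff_forall_not_mem.2 fun ρ hρ => k2 ρ hρ ?_
    have h1 := (k1 ρ).2 (Or.inl hρ)
    rw [mem_elimSet_of_max hr, Set.union_eq_self_of_subset_left h] at h1
    exact h1
  subst this
  obtain rfl : N = K := hl
  exact d1

theorem elimSet_injective (hM : Stable A M) (hN : Stable A N) (h : elimSet A M = elimSet A N) :
    M = N :=
  Dominates.antisymm hM hN ((dominates_iff_elimSet_subset hM hN).2 h.subset)
    ((dominates_iff_elimSet_subset hN hM).2 h.symm.subset)

theorem IsBoyOptimal.elimSet_eq_empty (h : IsBoyOptimal A M) : elimSet A M = ∅ := by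
  refine Set.eq_empty_of_forall_notMem fun ρ hρ => ?_
  obtain ⟨M', hM', k⟩ := ρ.2
  exact k.notMem_elimSet (elimSet_mono (h.2 M' hM') hρ)

/-- A sequence of eliminations from the boy-optimal matching to `M` contains exactly `elimSet A M`,
so precedence can be tested on these sets instead of on sequences. -/
theorem rotation_le_iff {ρ σ : Rotation A} :
    ρ ≤ σ ↔ ∀ M, Stable A M → σ ∈ elimSet A M → ρ ∈ elimSet A M := by
  constructor
  · rintro (rfl | h) M hM hσ
    · exact hσ
    obtain ⟨M₀, h₀⟩ := exists_isBoyOptimal A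
    obtain ⟨l, hl⟩ := exists_elimSeq h₀.1 hM (h₀.2 M hM)
    have k := (hl.spec h₀.1).2.2.1
    simp only [h₀.elimSet_eq_empty, Set.mem_empty_iff_false, or_false] at k
    obtain ⟨l₁, l₂, rfl⟩ := List.append_of_mem ((k σ).1 hσ)
    obtain ⟨M', k1, k2⟩ := hl.split
    exact (k ρ).2 (List.mem_append_left _ (h M₀ l₁ M' h₀ k1 k2))
  · intro h
    by_cases hne : ρ = σ
    · exact Or.inl hne
    refine Or.inr fun M₀ l M h₀ hl hM => ?_
    obtain ⟨hst, -, k, -, -⟩ := hl.spec h₀.1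
    simp only [h₀.elimSet_eq_empty, Set.mem_empty_iff_false, or_false] at k
    obtain ⟨N, hN⟩ := exists_eliminates hM
    have h1 := hN.elimSet_eq hst
    have h2 := h N (hN.stable hst).1 (by rw [h1]; exact Or.inl rfl)
    rw [h1] at h2
    exact (k ρ).1 (h2.resolve_left hne)

theorem rotation_le_antisymm {ρ σ : Rotation A} (h : ρ ≤ σ) (h' : σ ≤ ρ) : ρ = σ := by
  obtain ⟨M, hM, hσ⟩ := σ.2
  obtain ⟨N, hN⟩ := exists_eliminates hσ
  have h1 := hN.elimSet_eq hM
  have h2 := rotation_le_iff.1 h N (hN.stable hM).1 (by rw [h1]; exact Or.inl rfl)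
  rw [h1] at h2
  exact h2.resolve_right fun h3 => hσ.notMem_elimSet (rotation_le_iff.1 h' M hM h3)

theorem isLowerSet_elimSet (hM : Stable A M) : IsLowerSet (elimSet A M) :=
  fun _ _ h hσ => rotation_le_iff.1 h M hM hσ

/-- Take a smallest set containing `σ`. Meets intersect sets, so it lies inside every other set
containing `σ`; its members are therefore the predecessors of `σ`. -/
theorem exists_elimSet_eq_Iic (σ : Rotation A) : ∃ M, Stable A M ∧ elimSet A M = Set.Iic σ := by
  have hne : {M | Stable A M ∧ σ ∈ elimSet A M}.Nonempty := by
    obtain ⟨M, hM, hσ⟩ := σ.2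
    obtain ⟨N, hN⟩ := exists_eliminates hσ
    exact ⟨N, (hN.stable hM).1, by rw [hN.elimSet_eq hM]; exact Or.inl rfl⟩
  obtain ⟨M, ⟨hM, hσ⟩, hmin⟩ := WellFounded.has_min
    (InvImage.wf (fun M : Pairing Boy Girl => (elimSet A M).ncard) Nat.lt_wfRel.wf) _ hne
  refine ⟨M, hM, Set.Subset.antisymm (fun ρ hρ => ?_) fun ρ hρ => isLowerSet_elimSet hM hρ hσ⟩
  refine rotation_le_iff.2 fun N hN hσN => ?_
  by_contra hρN
  obtain ⟨K, hK, -, hr, -⟩ := exists_meet hM hN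
  have he := mem_elimSet_of_min hM hN hK hr
  refine hmin K ⟨hK, by rw [he]; exact ⟨hσ, hσN⟩⟩ (Set.ncard_lt_ncard ?_ (Set.toFinite _))
  rw [he]
  exact (Set.ssubset_iff_of_subset Set.inter_subset_left).2 ⟨ρ, hρ, fun h => hρN h.2⟩

/-- A closed set is a union of principal ones, and joins realise unions: a largest realisable subset
of `U` could otherwise absorb some `Set.Iic σ`. -/
theorem exists_elimSet_eq {U : Set (Rotation A)} (hU : IsLowerSet U) :
    ∃ M, Stable A M ∧ elimSet A M = U := by
  obtain ⟨M₀, h₀⟩ := exists_isBoyOptimal A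
  obtain ⟨M, ⟨hM, hMU⟩, hmin⟩ := WellFounded.has_min
    (InvImage.wf (fun M : Pairing Boy Girl => (U \ elimSet A M).ncard) Nat.lt_wfRel.wf)
    {M | Stable A M ∧ elimSet A M ⊆ U} ⟨M₀, h₀.1, by simp [h₀.elimSet_eq_empty]⟩
  refine ⟨M, hM, hMU.antisymm fun σ hσ => ?_⟩
  by_contra hσM
  obtain ⟨N, hN, hNσ⟩ := exists_elimSet_eq_Iic σ
  obtain ⟨K, hK, -, hr, -⟩ := exists_join hM hN
  have he := mem_elimSet_of_max hr
  rw [hNσ] at he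
  refine hmin K ⟨hK, ?_⟩ (Set.ncard_lt_ncard ?_ (Set.toFinite _))
  · rw [he]
    exact Set.union_subset hMU fun ρ hρ => hU hρ hσ
  · rw [he]
    refine (Set.ssubset_iff_of_subset (Set.sdiff_subset_sdiff_right Set.subset_union_left)).2
      ⟨σ, ⟨hσ, hσM⟩, fun h => h.2 (Or.inr (Set.mem_Iic.2 le_rfl))⟩

/-- Adding the first rotation of the list keeps the set closed, so a stable matching realises it.
The eliminations leading there can only be that one rotation. -/
theorem elimSeq_of_pairwise : ∀ {l : List (Rotation A)} {M N : Pairing Boy Girl}, Stable A M →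
    Stable A N → l.Nodup → (∀ ρ ∈ l, ρ ∉ elimSet A M) →
      (∀ ρ, ρ ∈ elimSet A N ↔ ρ ∈ l ∨ ρ ∈ elimSet A M) →
        l.Pairwise (fun ρ σ => ¬ σ < ρ) → ElimSeq A M l N
  | [], M, N, hM, hN, _, _, h, _ => elimSet_injective hM hN (by ext ρ; simp [h])
  | ρ :: l, M, N, hM, hN, hl, hd, h, hp => by
    obtain ⟨hl1, hl2⟩ := List.nodup_cons.1 hl
    obtain ⟨hp1, hp2⟩ := List.pairwise_cons.1 hp
    have hlow : IsLowerSet (insert ρ (elimSet A M)) := by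
      intro σ τ hτσ hσ
      rcases hσ with rfl | hσ
      swap
      · exact Or.inr (isLowerSet_elimSet hM hτσ hσ)
      by_cases hne : τ = σ
      · exact Or.inl hne
      have h1 : τ ∈ elimSet A N := isLowerSet_elimSet hN hτσ ((h σ).2 (Or.inl (by simp)))
      rcases (h τ).1 h1 with h2 | h2
      · rcases List.mem_cons.1 h2 with h3 | h3
        · exact absurd h3 hne
        · exact absurd (lt_of_le_not_ge hτσ fun h4 => hne (rotation_le_antisymm hτσ h4)) (hp1 τ h3)
      · exact Or.inr h2
    obtain ⟨M', hM', he⟩ := exists_elimSet_eq hlow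
    have hdom : Dominates A M M' := (dominates_iff_elimSet_subset hM hM').2 (by
      rw [he]
      exact Set.subset_insert _ _)
    obtain ⟨l', hl'⟩ := exists_elimSeq hM hM' hdom
    obtain ⟨-, -, k1, k2, k3⟩ := hl'.spec hM
    have hρM := hd ρ (by simp)
    have hl'ρ : l' = [ρ] := by
      have hall : ∀ σ ∈ l', σ = ρ := fun σ hσ => by
        have := (k1 σ).2 (Or.inl hσ)
        rw [he] at this
        exact this.resolve_right (k3 σ hσ)
      have hmem : ρ ∈ l' := ((k1 ρ).1 (by rw [he]; exact Or.inl rfl)).resolve_right hρM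
      exact List.perm_singleton.1 ((List.perm_ext_iff_of_nodup k2 (List.nodup_singleton _)).2
        fun σ => ⟨fun hσ => by simp [hall σ hσ], fun hσ => by
          rw [List.mem_singleton.1 hσ]
          exact hmem⟩)
    subst hl'ρ
    obtain ⟨M'', h1, h2⟩ := hl'
    obtain rfl : M'' = M' := h2
    refine ⟨M'', h1, elimSeq_of_pairwise hM' hN hl2 (fun σ hσ => ?_) (fun σ => ?_) hp2⟩
    · rw [he]
      rintro (rfl | h3)
      · exact hl1 hσ
      · exact hd σ (List.mem_cons_of_mem _ hσ) h3
    · rw [h, he, List.mem_cons, Set.mem_insert_iff]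
      tauto

theorem ElimSeq.pairwise : ∀ {l : List (Rotation A)} {M N : Pairing Boy Girl}, Stable A M →
    ElimSeq A M l N → l.Pairwise (fun ρ σ => ¬ σ < ρ)
  | [], _, _, _, _ => List.Pairwise.nil
  | ρ :: l, M, N, hM, h => by
    obtain ⟨M', h1, h2⟩ := h
    have h3 := (h1.stable hM).1
    refine List.pairwise_cons.2 ⟨fun σ hσ hlt => ?_, ElimSeq.pairwise h3 h2⟩
    refine (h2.spec h3).2.2.2.2 σ hσ (isLowerSet_elimSet h3 hlt.le ?_)
    rw [h1.elimSet_eq hM]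
    exact Or.inl rfl

theorem generates_elimSet (hM : Stable A M) : Generates A (elimSet A M) M := by
  obtain ⟨M₀, h₀⟩ := exists_isBoyOptimal A
  obtain ⟨l, hl⟩ := exists_elimSeq h₀.1 hM (h₀.2 M hM)
  have k := hl.spec h₀.1
  simp only [h₀.elimSet_eq_empty, Set.mem_empty_iff_false, or_false] at k
  refine ⟨isLowerSet_elimSet hM, M₀, h₀,
    ⟨l, k.2.2.2.1, fun ρ => (k.2.2.1 ρ).symm, hl.pairwise h₀.1⟩, fun l' hl' => ?_⟩
  refine elimSeq_of_pairwise h₀.1 hM hl'.1 ?_ ?_ hl'.2.2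
  · simp [h₀.elimSet_eq_empty]
  · simp [h₀.elimSet_eq_empty, hl'.2.1]

end Rotations

/-! ### The effect of a shift on stability -/

theorem idxOf_moveUp {α : Type*} [DecidableEq α] {l : List α} {x y : α} (hl : l.Nodup)
    (hx : x ∈ l) (h : l.idxOf y < l.idxOf x) (u : α) : (moveUp l x y).idxOf u =
      if u = x then l.idxOf y
      else if l.idxOf y ≤ l.idxOf u ∧ l.idxOf u < l.idxOf x then l.idxOf u + 1 else l.idxOf u := by
  obtain ⟨l', l₃, rfl⟩ := List.append_of_mem hx
  have hx' : x ∉ l' := fun hm => (List.nodup_append.1 hl).2.2 x hm x (by simp) rfl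
  have hy : y ∈ l' := by
    by_contra hy
    rw [List.idxOf_append_of_notMem hy, List.idxOf_append_of_notMem hx', List.idxOf_cons_self] at h
    omega
  obtain ⟨l₁, l₂, rfl⟩ := List.append_of_mem hy
  rw [moveUp_eq _ _ _ _ _ hl]
  have hxy : x ≠ y := by rintro rfl; exact hx' hy
  have hy1 : y ∉ l₁ := by grind
  have hx1 : x ∉ l₁ := by grind
  have hx2 : x ∉ l₂ := by grind
  have ey : (l₁ ++ y :: l₂ ++ x :: l₃).idxOf y = l₁.length := by
    simp [List.idxOf_append, hy1]
  have ex : (l₁ ++ y :: l₂ ++ x :: l₃).idxOf x = l₁.length + 1 + l₂.length := by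
    simp [List.idxOf_append, hx1, hx2, hxy.symm]
    omega
  rw [ex, ey]
  by_cases hux : u = x
  · subst hux
    simp [List.idxOf_append, hx1]
  rw [if_neg hux]
  by_cases hu1 : u ∈ l₁
  · have := List.idxOf_lt_length_of_mem hu1
    simp [List.idxOf_append, hu1]
    omega
  by_cases huy : u = y
  · subst huy
    simp [List.idxOf_append, hu1, hxy]
    split_ifs <;> omega
  have hxu : x ≠ u := fun h => hux h.symm
  have hyu : y ≠ u := fun h => huy h.symm
  by_cases hu2 : u ∈ l₂
  · have := List.idxOf_lt_length_of_mem hu2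
    simp [List.idxOf_append, hu1, hu2, hxu, hyu]
    split_ifs <;> omega
  · simp [List.idxOf_append, hu1, hu2, hxu, hyu]
    split_ifs <;> omega

section Shifts

set_option linter.unusedSectionVars false

variable {Boy Girl : Type*} [DecidableEq Boy] [DecidableEq Girl]
  {A : SMInstance Boy Girl} {M N K : Pairing Boy Girl}

theorem stable_iff_of_boyList_eq {B : SMInstance Boy Girl} (hM : Stable A M)
    (hB : ∀ b g, g ∈ B.boyList b ↔ g ∈ A.boyList b) :
    ¬ Stable B M ↔ ∃ b g, g ∈ A.boyList b ∧ (B.boyList b).idxOf g < boyRank B b (M b) ∧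
      (B.girlList g).idxOf b < girlRank B g (M.symm g) := by
  constructor
  · intro h
    by_contra! hc
    refine h ⟨fun b g hg => (hB b g).2 (hM.1 b g hg), fun b g hbl => ?_⟩
    obtain ⟨h1, h2, h3⟩ := blocks_iff.1 hbl
    exact (hc b g ((hB b g).1 h1) h2).not_gt h3
  · rintro ⟨b, g, h1, h2⟩ h
    exact h.2 b g (blocks_iff.2 ⟨(hB b g).2 h1, h2⟩)

/-- Only the shifted pair can begin to block: for any other boy the order relative to the girl's
partner is unchanged, or the partner is `b` and has risen. After the shift `b` beats precisely the
other boys at or below the old place of `b₁`. Strict preference is written with `+ 1` so that both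
conditions are lower bounds on ranks. -/
theorem not_stable_girlShift (hM : Stable A M)
    (x : {x : Girl × Boy × Boy // x.2.1 ∈ A.girlList x.1 ∧ A.GirlPrefers x.1 x.2.2 x.2.1}) :
    ¬ Stable (A.applyShift (Sum.inl x)) M ↔
      (A.boyList x.1.2.1).idxOf x.1.1 + 1 ≤ boyRank A x.1.2.1 (M x.1.2.1) ∧
        (A.girlList x.1.1).idxOf x.1.2.2 ≤ girlRank A x.1.1 (M.symm x.1.1) := by
  obtain ⟨⟨g, b, b₁⟩, hb, hlt⟩ := x
  simp only at hb hlt ⊢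
  set B := A.applyShift (Sum.inl ⟨(g, b, b₁), hb, hlt⟩)
  have hBb : B.boyList = A.boyList := rfl
  have hBg : B.girlList = Function.update A.girlList g (moveUp (A.girlList g) b b₁) := rfl
  have hrb : ∀ b o, boyRank B b o = boyRank A b o := fun b o => by cases o <;> rfl
  have hne : ∀ g' ≠ g, B.girlList g' = A.girlList g' := fun g' h => by
    rw [hBg, Function.update_of_ne h]
  have hrne : ∀ g' ≠ g, ∀ o, girlRank B g' o = girlRank A g' o := fun g' h o => by
    cases o <;> simp only [girlRank, hne g' h]
  have hidx := idxOf_moveUp (A.girlList_nodup g) hb hlt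
  have hBg' : B.girlList g = moveUp (A.girlList g) b b₁ := by rw [hBg, Function.update_self]
  unfold SMInstance.GirlPrefers at hlt
  have hlen := List.idxOf_lt_length_of_mem hb
  have hrg : ∀ o, girlRank B g o = if o = some b then (A.girlList g).idxOf b₁ else
      if (A.girlList g).idxOf b₁ ≤ girlRank A g o ∧ girlRank A g o < (A.girlList g).idxOf b then
        girlRank A g o + 1 else girlRank A g o := fun o => by
    rcases o with _ | b'
    · have e : girlRank A g none = (A.girlList g).length := rfl
      have e' : girlRank B g none = (A.girlList g).length :=
        (congrArg List.length hBg').trans (moveUp_perm b₁ hb).length_eq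
      rw [if_neg (by simp), if_neg (by omega), e, e']
    · rw [girlRank_some, girlRank_some, hBg', hidx]
      by_cases h : b' = b
      · rw [if_pos h, if_pos (congrArg some h)]
      · rw [if_neg h, if_neg (fun h' => h (Option.some.inj h'))]
  rw [stable_iff_of_boyList_eq hM (fun b g => by rw [hBb])]
  simp only [hBb, hrb]
  constructor
  · rintro ⟨b', g', h1, h2, h3⟩
    have hst := hM.le_or_le h1
    by_cases hg' : g' = g
    · subst hg'
      rw [hrg, hBg', hidx] at h3
      by_cases hb' : b' = b
      · subst hb'
        refine ⟨h2, ?_⟩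
        rw [if_pos rfl] at h3
        split_ifs at h3 <;> omega
      · exfalso
        rw [if_neg hb'] at h3
        by_cases ho : M.symm g' = some b
        · rw [ho, girlRank_some] at hst
          rw [if_pos ho] at h3
          split_ifs at h3 <;> omega
        · rw [if_neg ho] at h3
          split_ifs at h3 <;> omega
    · exfalso
      rw [hrne g' hg', hne g' hg'] at h3
      omega
  · rintro ⟨h1, h2⟩
    have hbg := (A.mem_iff b g).2 hb
    refine ⟨b, g, hbg, h1, ?_⟩
    have ho : M.symm g ≠ some b := fun ho => by
      rw [symm_eq_some.1 ho, boyRank_some] at h1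
      omega
    rw [hrg, if_neg ho, hBg', hidx, if_pos rfl]
    split_ifs <;> omega

theorem not_stable_boyShift (hM : Stable A M)
    (x : {x : Boy × Girl × Girl // x.2.1 ∈ A.boyList x.1 ∧ A.BoyPrefers x.1 x.2.2 x.2.1}) :
    ¬ Stable (A.applyShift (Sum.inr x)) M ↔
      (A.boyList x.1.1).idxOf x.1.2.2 ≤ boyRank A x.1.1 (M x.1.1) ∧
        (A.girlList x.1.2.1).idxOf x.1.1 + 1 ≤ girlRank A x.1.2.1 (M.symm x.1.2.1) := by
  obtain ⟨⟨b, g, g₁⟩, hg, hlt⟩ := x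
  simp only at hg hlt ⊢
  set B := A.applyShift (Sum.inr ⟨(b, g, g₁), hg, hlt⟩)
  have hBg : B.girlList = A.girlList := rfl
  have hBb : B.boyList = Function.update A.boyList b (moveUp (A.boyList b) g g₁) := rfl
  have hrg : ∀ g o, girlRank B g o = girlRank A g o := fun g o => by cases o <;> rfl
  have hne : ∀ b' ≠ b, B.boyList b' = A.boyList b' := fun b' h => by
    rw [hBb, Function.update_of_ne h]
  have hrne : ∀ b' ≠ b, ∀ o, boyRank B b' o = boyRank A b' o := fun b' h o => by
    cases o <;> simp only [boyRank, hne b' h]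
  have hidx := idxOf_moveUp (A.boyList_nodup b) hg hlt
  have hBb' : B.boyList b = moveUp (A.boyList b) g g₁ := by rw [hBb, Function.update_self]
  unfold SMInstance.BoyPrefers at hlt
  have hlen := List.idxOf_lt_length_of_mem hg
  have hrb : ∀ o, boyRank B b o = if o = some g then (A.boyList b).idxOf g₁ else
      if (A.boyList b).idxOf g₁ ≤ boyRank A b o ∧ boyRank A b o < (A.boyList b).idxOf g then
        boyRank A b o + 1 else boyRank A b o := fun o => by
    rcases o with _ | g'
    · have e : boyRank A b none = (A.boyList b).length := rfl
      have e' : boyRank B b none = (A.boyList b).length :=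
        (congrArg List.length hBb').trans (moveUp_perm g₁ hg).length_eq
      rw [if_neg (by simp), if_neg (by omega), e, e']
    · rw [boyRank_some, boyRank_some, hBb', hidx]
      by_cases h : g' = g
      · rw [if_pos h, if_pos (congrArg some h)]
      · rw [if_neg h, if_neg (fun h' => h (Option.some.inj h'))]
  rw [stable_iff_of_boyList_eq hM (fun b g => by rw [B.mem_iff, hBg, A.mem_iff])]
  simp only [hBg, hrg]
  constructor
  · rintro ⟨b', g', h1, h2, h3⟩
    have hst := hM.le_or_le h1
    by_cases hb' : b' = b
    · subst hb'
      rw [hrb, hBb', hidx] at h2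
      by_cases hg' : g' = g
      · subst hg'
        refine ⟨?_, h3⟩
        rw [if_pos rfl] at h2
        split_ifs at h2 <;> omega
      · exfalso
        rw [if_neg hg'] at h2
        by_cases ho : M b' = some g
        · rw [ho, boyRank_some] at hst
          rw [if_pos ho] at h2
          split_ifs at h2 <;> omega
        · rw [if_neg ho] at h2
          split_ifs at h2 <;> omega
    · exfalso
      rw [hrne b' hb', hne b' hb'] at h2
      omega
  · rintro ⟨h1, h2⟩
    refine ⟨b, g, hg, ?_, h2⟩
    have ho : M b ≠ some g := fun ho => by
      rw [symm_eq_some.2 ho, girlRank_some] at h2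
      omega
    rw [hrb, if_neg ho, hBb', hidx, if_pos rfl]
    split_ifs <;> omega

theorem exists_mem_lostSet_iff (A : SMInstance Boy Girl) (B : Shift A) :
    ∃ b k g k', ∀ M, Stable A M →
      (M ∈ lostSet A B ↔ k ≤ boyRank A b (M b) ∧ k' ≤ girlRank A g (M.symm g)) := by
  rcases B with x | x
  · exact ⟨_, _, _, _, fun M hM => (and_iff_right hM).trans (not_stable_girlShift hM x)⟩
  · exact ⟨_, _, _, _, fun M hM => (and_iff_right hM).trans (not_stable_boyShift hM x)⟩

end Shifts

/-! ### Vertices of the network and sides of cuts -/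

section Vertices

set_option linter.unusedSectionVars false

variable {Boy Girl : Type*} [DecidableEq Boy] [DecidableEq Girl] {A : SMInstance Boy Girl}

theorem vertex_cases (v : Vertex A) : v = ⊥ ∨ v = ⊤ ∨ ∃ ρ, v = rotVertex ρ := by
  induction v using WithBot.recBotCoe with
  | bot => exact Or.inl rfl
  | coe v =>
    induction v using WithTop.recTopCoe with
    | top => exact Or.inr (Or.inl rfl)
    | coe ρ => exact Or.inr (Or.inr ⟨ρ, rfl⟩)

theorem rotVertex_ne_bot (ρ : Rotation A) : rotVertex ρ ≠ ⊥ := WithBot.coe_ne_bot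

theorem rotVertex_ne_top (ρ : Rotation A) : rotVertex ρ ≠ ⊤ :=
  fun h => WithTop.coe_ne_top (WithBot.coe_injective h)

theorem bot_ne_top_vertex : (⊥ : Vertex A) ≠ ⊤ := WithBot.bot_ne_coe

theorem rotVertex_injective : Function.Injective (rotVertex (A := A)) :=
  fun _ _ h => WithTop.coe_injective (WithBot.coe_injective h)

theorem rotVertex_le {ρ σ : Rotation A} : rotVertex ρ ≤ rotVertex σ ↔ ρ ≤ σ :=
  WithBot.coe_le_coe.trans WithTop.coe_le_coe

theorem not_top_le_rotVertex (ρ : Rotation A) : ¬ (⊤ : Vertex A) ≤ rotVertex ρ :=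
  fun h => WithTop.not_top_le_coe ρ (WithBot.coe_le_coe.1 h)

theorem not_rotVertex_le_bot (ρ : Rotation A) : ¬ rotVertex ρ ≤ (⊥ : Vertex A) :=
  WithBot.not_coe_le_bot _

theorem not_top_le_bot_vertex : ¬ (⊤ : Vertex A) ≤ ⊥ :=
  WithBot.not_coe_le_bot _

/-- The vertices `s` and those of the rotations in `U`. -/
def sideSet (U : Set (Rotation A)) : Set (Vertex A) := {v | v = ⊥ ∨ ∃ ρ ∈ U, v = rotVertex ρ}

theorem bot_mem_sideSet (U : Set (Rotation A)) : ⊥ ∈ sideSet U := Or.inl rfl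

theorem top_notMem_sideSet (U : Set (Rotation A)) : ⊤ ∉ sideSet U := by
  rintro (h | ⟨ρ, -, h⟩)
  · exact bot_ne_top_vertex h.symm
  · exact rotVertex_ne_top ρ h.symm

theorem rotVertex_mem_sideSet {U : Set (Rotation A)} {ρ : Rotation A} :
    rotVertex ρ ∈ sideSet U ↔ ρ ∈ U := by
  constructor
  · rintro (h | ⟨σ, hσ, h⟩)
    · exact absurd h (rotVertex_ne_bot ρ)
    · rwa [rotVertex_injective h]
  · exact fun h => Or.inr ⟨ρ, h, rfl⟩

theorem sideSet_mono {U V : Set (Rotation A)} (h : U ⊆ V) : sideSet U ⊆ sideSet V := by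
  rintro v (hv | ⟨ρ, hρ, hv⟩)
  · exact Or.inl hv
  · exact Or.inr ⟨ρ, h hρ, hv⟩

theorem isLowerSet_sideSet {U : Set (Rotation A)} (hU : IsLowerSet U) :
    IsLowerSet (sideSet U) := by
  rintro v w hwv hv
  rcases vertex_cases w with rfl | rfl | ⟨σ, rfl⟩
  · exact bot_mem_sideSet U
  · exfalso
    rcases hv with rfl | ⟨ρ, -, rfl⟩
    · exact not_top_le_bot_vertex hwv
    · exact not_top_le_rotVertex ρ hwv
  · rcases hv with rfl | ⟨ρ, hρ, rfl⟩
    · exact absurd hwv (not_rotVertex_le_bot σ)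
    · exact rotVertex_mem_sideSet.2 (hU (rotVertex_le.1 hwv) hρ)

theorem sideSet_eq {X : Set (Vertex A)} (h : ⊥ ∈ X) (h' : ⊤ ∉ X) :
    sideSet {ρ | rotVertex ρ ∈ X} = X := by
  ext v
  rcases vertex_cases v with rfl | rfl | ⟨ρ, rfl⟩
  · exact iff_of_true (bot_mem_sideSet _) h
  · exact iff_of_false (top_notMem_sideSet _) h'
  · exact rotVertex_mem_sideSet

end Vertices

/-! ### Lost sets and the ends of error edges -/

section LostSets

set_option linter.unusedSectionVars false

variable {Boy Girl : Type*} [DecidableEq Boy] [DecidableEq Girl] [Fintype Boy] [Fintype Girl]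
  {A : SMInstance Boy Girl} {M N K : Pairing Boy Girl}

/-- A prime filter of the lattice of stable matchings is given by a vertex. -/
theorem exists_vertex_of_primeFilter {P : Pairing Boy Girl → Prop}
    (mono : ∀ M N, Stable A M → Stable A N → elimSet A M ⊆ elimSet A N → P M → P N)
    (inf : ∀ M N K, Stable A M → Stable A N → Stable A K →
      elimSet A K = elimSet A M ∩ elimSet A N → P M → P N → P K)
    (sup : ∀ M N K, Stable A M → Stable A N → Stable A K →
      elimSet A K = elimSet A M ∪ elimSet A N → P K → P M ∨ P N) :
    ∃ v : Vertex A, ∀ M, Stable A M → (P M ↔ v ∈ sideSet (elimSet A M)) := by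
  by_cases hall : ∀ M, Stable A M → P M
  · exact ⟨⊥, fun M hM => iff_of_true (hall M hM) (bot_mem_sideSet _)⟩
  by_cases hnone : ∀ M, Stable A M → ¬ P M
  · exact ⟨⊤, fun M hM => iff_of_false (hnone M hM) (top_notMem_sideSet _)⟩
  push Not at hall hnone
  obtain ⟨M, ⟨hM, hPM⟩, hmin⟩ := WellFounded.has_min
    (InvImage.wf (fun M : Pairing Boy Girl => (elimSet A M).ncard) Nat.lt_wfRel.wf)
    {M | Stable A M ∧ P M} hnone
  have hne : (elimSet A M).Nonempty := by
    by_contra hc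
    obtain ⟨N, hN, hPN⟩ := hall
    refine hPN (mono M N hM hN ?_ hPM)
    rw [Set.not_nonempty_iff_eq_empty.1 hc]
    exact Set.empty_subset _
  -- `M` is the least member of the filter. Removing a maximal rotation leaves a closed set, whose
  -- matching `L` fails `P` by minimality.
  obtain ⟨ρ, hρ, hmax⟩ := (Set.toFinite (elimSet A M)).exists_maximal hne
  have hlow : IsLowerSet (elimSet A M \ {ρ}) := by
    rintro σ τ hτσ ⟨hσ, hσρ⟩
    refine ⟨isLowerSet_elimSet hM hτσ hσ, ?_⟩
    rintro rfl
    exact hσρ (rotation_le_antisymm (hmax hσ hτσ) hτσ)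
  obtain ⟨L, hL, hLe⟩ := exists_elimSet_eq hlow
  have hPL : ¬ P L := fun h => hmin L ⟨hL, h⟩ (Set.ncard_lt_ncard (by
    rw [hLe]
    exact Set.sdiff_singleton_ssubset.2 hρ) (Set.toFinite _))
  refine ⟨rotVertex ρ, fun N hN => ?_⟩
  rw [rotVertex_mem_sideSet]
  constructor
  · intro hPN
    by_contra hρN
    obtain ⟨K, hK, -, hr, -⟩ := exists_meet hM hN
    have he := mem_elimSet_of_min hM hN hK hr
    refine hmin K ⟨hK, inf M N K hM hN hK he hPM hPN⟩ (Set.ncard_lt_ncard ?_ (Set.toFinite _))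
    rw [he]
    exact (Set.ssubset_iff_of_subset Set.inter_subset_left).2 ⟨ρ, hρ, fun h => hρN h.2⟩
  · intro hρN
    obtain ⟨K, hK, -, hr, -⟩ := exists_join hL hN
    have he := mem_elimSet_of_max hr
    -- The join of `L` and `N` recovers `ρ` from `N`, so it lies above `M` and satisfies `P`.
    -- Primeness passes `P` to `N`, since `L` fails it.
    refine (sup L N K hL hN hK he (mono M K hM hK ?_ hPM)).resolve_left hPL
    rw [he, hLe]
    intro σ hσ
    by_cases hσρ : σ = ρ
    · exact Or.inr (hσρ ▸ hρN)
    · exact Or.inl ⟨hσ, hσρ⟩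

theorem ranks_of_inter (hM : Stable A M) (hN : Stable A N) (hK : Stable A K)
    (h : elimSet A K = elimSet A M ∩ elimSet A N) :
    (∀ b, boyRank A b (K b) = min (boyRank A b (M b)) (boyRank A b (N b))) ∧
    ∀ g, girlRank A g (K.symm g) = max (girlRank A g (M.symm g)) (girlRank A g (N.symm g)) := by
  obtain ⟨L, hL, -, h1, h2⟩ := exists_meet hM hN
  obtain rfl := elimSet_injective hK hL (h.trans (mem_elimSet_of_min hM hN hL h1).symm)
  exact ⟨h1, h2⟩

theorem ranks_of_union (hM : Stable A M) (hN : Stable A N) (hK : Stable A K)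
    (h : elimSet A K = elimSet A M ∪ elimSet A N) :
    (∀ b, boyRank A b (K b) = max (boyRank A b (M b)) (boyRank A b (N b))) ∧
    ∀ g, girlRank A g (K.symm g) = min (girlRank A g (M.symm g)) (girlRank A g (N.symm g)) := by
  obtain ⟨L, hL, -, h1, h2⟩ := exists_join hM hN
  obtain rfl := elimSet_injective hK hL (h.trans (mem_elimSet_of_max h1).symm)
  exact ⟨h1, h2⟩

/-- Boys' ranks grow along the lattice while girls' ranks fall, and both turn meets and joins into
`min` and `max`. So the boy's threshold gives a prime filter, and so does the negation of the
girl's. -/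
theorem exists_vertices_mem_lostSet_iff (A : SMInstance Boy Girl) (B : Shift A) :
    ∃ v w : Vertex A, ∀ M, Stable A M →
      (M ∈ lostSet A B ↔ v ∈ sideSet (elimSet A M) ∧ w ∉ sideSet (elimSet A M)) := by
  obtain ⟨b, k, g, k', h⟩ := exists_mem_lostSet_iff A B
  obtain ⟨v, hv⟩ := exists_vertex_of_primeFilter (A := A) (P := fun M => k ≤ boyRank A b (M b))
    (fun M N hM hN hMN hk => hk.trans ((dominates_iff_elimSet_subset hM hN).2 hMN b))
    (fun M N K hM hN hK he hkM hkN => by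
      simp only [(ranks_of_inter hM hN hK he).1 b]
      omega)
    (fun M N K hM hN hK he hkK => by
      simp only [(ranks_of_union hM hN hK he).1 b] at hkK
      omega)
  obtain ⟨w, hw⟩ := exists_vertex_of_primeFilter (A := A)
    (P := fun M => girlRank A g (M.symm g) < k')
    (fun M N hM hN hMN hk =>
      (((dominates_iff_elimSet_subset hM hN).2 hMN).girlRank_le hM hN g).trans_lt hk)
    (fun M N K hM hN hK he hkM hkN => by
      simp only [(ranks_of_inter hM hN hK he).2 g]
      omega)
    (fun M N K hM hN hK he hkK => by
      simp only [(ranks_of_union hM hN hK he).2 g] at hkK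
      omega)
  refine ⟨v, w, fun M hM => ?_⟩
  rw [h M hM, ← hv M hM, ← hw M hM, not_lt]

theorem eliminates_of_elimSet_eq {ρ : Rotation A} (hM : Stable A M) (hN : Stable A N)
    (hρ : ρ ∉ elimSet A M) (h : elimSet A N = insert ρ (elimSet A M)) : Eliminates A M ρ N := by
  obtain ⟨M', h1, h2⟩ := elimSeq_of_pairwise (l := [ρ]) hM hN (by simp) (by simpa using hρ)
    (fun σ => by rw [h]; simp) (by simp)
  obtain rfl : M' = N := h2
  exact h1

/-- Passing into the lost set must add `v`, as nothing eliminated can remove `w`. Conversely, the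
step that completes `Set.Iic ρ` enters the lost set; `w` is not yet present, being not below `v`. -/
theorem rotationsInto_eq {B : Shift A} {v w : Vertex A}
    (h : ∀ M, Stable A M →
      (M ∈ lostSet A B ↔ v ∈ sideSet (elimSet A M) ∧ w ∉ sideSet (elimSet A M)))
    (hvw : ¬ w ≤ v) : rotationsInto A B = {ρ | v = rotVertex ρ} := by
  ext ρ
  constructor
  · rintro ⟨M, N, hM, hMl, hE, hNl⟩
    have hN := (hE.stable hM).1
    rw [h M hM] at hMl
    rw [h N hN, hE.elimSet_eq hM] at hNl
    rcases hNl.1 with hv | ⟨σ, rfl | hσ, hv⟩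
    · exact absurd ⟨Or.inl hv, fun hw => hNl.2 (sideSet_mono (Set.subset_insert _ _) hw)⟩ hMl
    · exact hv
    · exact absurd ⟨Or.inr ⟨σ, hσ, hv⟩,
        fun hw => hNl.2 (sideSet_mono (Set.subset_insert _ _) hw)⟩ hMl
  · rintro rfl
    obtain ⟨N, hN, hNe⟩ := exists_elimSet_eq_Iic ρ
    have hlow : IsLowerSet (Set.Iic ρ \ {ρ}) := by
      rintro σ τ hτσ ⟨hσ, hσρ⟩
      refine ⟨hτσ.trans hσ, ?_⟩
      rintro rfl
      exact hσρ (rotation_le_antisymm hσ hτσ)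
    obtain ⟨M, hM, hMe⟩ := exists_elimSet_eq hlow
    have hρM : ρ ∉ elimSet A M := by simp [hMe]
    refine ⟨M, N, hM, fun hl => ?_, eliminates_of_elimSet_eq hM hN hρM ?_, ?_⟩
    · exact hρM (rotVertex_mem_sideSet.1 ((h M hM).1 hl).1)
    · rw [hMe, hNe, Set.insert_sdiff_singleton, Set.insert_eq_of_mem (Set.mem_Iic.2 le_rfl)]
    · refine (h N hN).2 ⟨rotVertex_mem_sideSet.2 (by simp [hNe]), ?_⟩
      rw [hNe]
      rintro (rfl | ⟨σ, hσ, rfl⟩)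
      · exact hvw bot_le
      · exact hvw (rotVertex_le.2 hσ)

theorem rotationsOutOf_eq {B : Shift A} {v w : Vertex A}
    (h : ∀ M, Stable A M →
      (M ∈ lostSet A B ↔ v ∈ sideSet (elimSet A M) ∧ w ∉ sideSet (elimSet A M)))
    (hvw : ¬ w ≤ v) : rotationsOutOf A B = {ρ | w = rotVertex ρ} := by
  ext ρ
  constructor
  · rintro ⟨M, N, hMl, hE, hN, hNl⟩
    have hM := hMl.1
    rw [h M hM] at hMl
    rw [h N hN, hE.elimSet_eq hM] at hNl
    have hw : w ∈ sideSet (insert ρ (elimSet A M)) := by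
      by_contra hw
      exact hNl ⟨sideSet_mono (Set.subset_insert _ _) hMl.1, hw⟩
    rcases hw with hw | ⟨σ, rfl | hσ, hw⟩
    · exact absurd (Or.inl hw) hMl.2
    · exact hw
    · exact absurd (Or.inr ⟨σ, hσ, hw⟩) hMl.2
  · rintro rfl
    -- The matching to leave from must contain `v` and everything strictly below `ρ`, but not `ρ`;
    -- this is the least such closed set.
    have hlow : IsLowerSet ((Set.Iic ρ \ {ρ}) ∪ {σ | rotVertex σ ≤ v}) := by
      rintro σ τ hτσ (⟨hσ, hσρ⟩ | hσ)
      · refine Or.inl ⟨hτσ.trans hσ, ?_⟩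
        rintro rfl
        exact hσρ (rotation_le_antisymm hσ hτσ)
      · exact Or.inr ((rotVertex_le.2 hτσ).trans hσ)
    have hlow' : IsLowerSet (insert ρ ((Set.Iic ρ \ {ρ}) ∪ {σ | rotVertex σ ≤ v})) := by
      rintro σ τ hτσ (rfl | hσ)
      · by_cases hne : τ = σ
        · exact Or.inl hne
        · exact Or.inr (Or.inl ⟨hτσ, hne⟩)
      · exact Or.inr (hlow hτσ hσ)
    obtain ⟨M, hM, hMe⟩ := exists_elimSet_eq hlow
    obtain ⟨N, hN, hNe⟩ := exists_elimSet_eq hlow'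
    have hρM : ρ ∉ elimSet A M := by simp [hMe, hvw]
    refine ⟨M, N, (h M hM).2 ⟨?_, ?_⟩, eliminates_of_elimSet_eq hM hN hρM ?_, hN, fun hl => ?_⟩
    · rcases vertex_cases v with rfl | rfl | ⟨σ, rfl⟩
      · exact bot_mem_sideSet _
      · exact absurd le_top hvw
      · rw [rotVertex_mem_sideSet, hMe]
        exact Or.inr (le_refl (rotVertex σ))
    · rwa [rotVertex_mem_sideSet]
    · rw [hNe, hMe]
    · refine ((h N hN).1 hl).2 (rotVertex_mem_sideSet.2 ?_)
      rw [hNe]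
      exact Set.mem_insert _ _

/-- If `w ≤ v` the lost set is empty and there is no edge. Otherwise each of the two sets of
rotations has at most one element, and the defaults `⊥` and `⊤` are just the values of `v` and `w`
when it has none. -/
theorem mem_lostSet_iff_of_errorEdge (B : ErrorEdge A) (hM : Stable A M) : M ∈ lostSet A B.1 ↔
    inVertex A B.1 ∈ sideSet (elimSet A M) ∧ outVertex A B.1 ∉ sideSet (elimSet A M) := by
  obtain ⟨v, w, h⟩ := exists_vertices_mem_lostSet_iff A B.1
  have hvw : ¬ w ≤ v := by
    intro hvw
    have hempty : ∀ M, M ∉ lostSet A B.1 := fun M hl => by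
      have h1 := (h M hl.1).1 hl
      exact h1.2 (isLowerSet_sideSet (isLowerSet_elimSet hl.1) hvw h1.1)
    rcases B.2 with ⟨ρ, M, N, -, -, -, hN⟩ | ⟨ρ, M, N, hM, -⟩
    · exact hempty N hN
    · exact hempty M hM
  have hin : inVertex A B.1 = v := by
    unfold inVertex
    rw [rotationsInto_eq h hvw]
    rcases vertex_cases v with rfl | rfl | ⟨ρ, rfl⟩
    · rw [dif_neg]
      rintro ⟨ρ, hρ⟩
      exact rotVertex_ne_bot ρ hρ.symm
    · exact absurd le_top hvw
    · have hne : {σ | rotVertex ρ = rotVertex σ}.Nonempty := ⟨ρ, rfl⟩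
      rw [dif_pos hne]
      exact hne.some_mem.symm
  have hout : outVertex A B.1 = w := by
    unfold outVertex
    rw [rotationsOutOf_eq h hvw]
    rcases vertex_cases w with rfl | rfl | ⟨ρ, rfl⟩
    · exact absurd bot_le hvw
    · rw [dif_neg]
      rintro ⟨ρ, hρ⟩
      exact rotVertex_ne_top ρ hρ.symm
    · have hne : {σ | rotVertex ρ = rotVertex σ}.Nonempty := ⟨ρ, rfl⟩
      rw [dif_pos hne]
      exact hne.some_mem.symm
  rw [hin, hout]
  exact h M hM

/-- A shift without an edge loses either nothing or every stable matching, so it does not affect the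
comparison of probabilities. -/
theorem mem_lostSet_iff_of_not_errorEdge {B : Shift A}
    (hB : ¬ ((rotationsInto A B).Nonempty ∨ (rotationsOutOf A B).Nonempty)) (hM : Stable A M)
    (hN : Stable A N) : M ∈ lostSet A B ↔ N ∈ lostSet A B := by
  obtain ⟨v, w, h⟩ := exists_vertices_mem_lostSet_iff A B
  by_cases hvw : w ≤ v
  · have hempty : ∀ M, M ∉ lostSet A B := fun M hl => by
      have h1 := (h M hl.1).1 hl
      exact h1.2 (isLowerSet_sideSet (isLowerSet_elimSet hl.1) hvw h1.1)
    exact iff_of_false (hempty M) (hempty N)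
  · rw [rotationsInto_eq h hvw, rotationsOutOf_eq h hvw] at hB
    have hv : v = ⊥ := by
      rcases vertex_cases v with rfl | rfl | ⟨ρ, rfl⟩
      · rfl
      · exact absurd le_top hvw
      · exact absurd (Or.inl ⟨ρ, rfl⟩) hB
    have hw : w = ⊤ := by
      rcases vertex_cases w with rfl | rfl | ⟨ρ, rfl⟩
      · exact absurd bot_le hvw
      · rfl
      · exact absurd (Or.inr ⟨ρ, rfl⟩) hB
    rw [h M hM, h N hN, hv, hw]
    exact iff_of_true ⟨bot_mem_sideSet _, top_notMem_sideSet _⟩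
      ⟨bot_mem_sideSet _, top_notMem_sideSet _⟩

end LostSets

/-! ### Maximum flows, minimum cuts and robustness -/

section Flow

set_option linter.unusedSectionVars false

open Classical Filter Topology

variable {Boy Girl : Type*} [DecidableEq Boy] [DecidableEq Girl] [Fintype Boy] [Fintype Girl]
  {A : SMInstance Boy Girl} {p : Shift A → ℝ} {φ : EdgeFlow A}

/-- The edges of the network. -/
abbrev NetEdge (A : SMInstance Boy Girl) : Type _ := HasseEdge A ⊕ ErrorEdge A

/-- The initial vertex of an edge. -/
noncomputable def edgeSrc : NetEdge A → Vertex A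
  | Sum.inl e => e.1.1
  | Sum.inr B => outVertex A B.1

/-- The final vertex of an edge. -/
noncomputable def edgeTgt : NetEdge A → Vertex A
  | Sum.inl e => e.1.2
  | Sum.inr B => inVertex A B.1

/-- The flow values as a function on all edges. -/
def EdgeFlow.val (φ : EdgeFlow A) : NetEdge A → ℝ := Sum.elim φ.f φ.g

/-- Indicator of membership, as a real number. -/
noncomputable def indic {α : Type*} (X : Set α) (a : α) : ℝ := if a ∈ X then 1 else 0

/-- Net amount leaving the vertex `u`. -/
noncomputable def netOut (x : NetEdge A → ℝ) (u : Vertex A) : ℝ :=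
  ∑ e, x e * (indic {u} (edgeSrc e) - indic {u} (edgeTgt e))

theorem netOut_val (φ : EdgeFlow A) (u : Vertex A) :
    netOut φ.val u = φ.outflow u - φ.inflow u := by
  unfold netOut EdgeFlow.outflow EdgeFlow.inflow indic
  simp only [Fintype.sum_sum_type, EdgeFlow.val, Sum.elim_inl, Sum.elim_inr, edgeSrc, edgeTgt,
    mul_sub, mul_ite, mul_one, mul_zero, Finset.sum_sub_distrib, Set.mem_singleton_iff]

theorem netOut_add_smul (x y : NetEdge A → ℝ) (c : ℝ) (u : Vertex A) :
    netOut (fun e => x e + c * y e) u = netOut x u + c * netOut y u := by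
  unfold netOut
  rw [Finset.mul_sum, ← Finset.sum_add_distrib]
  exact Finset.sum_congr rfl fun e _ => by ring

theorem netOut_single (e : NetEdge A) (u : Vertex A) :
    netOut (Pi.single e 1) u = indic {u} (edgeSrc e) - indic {u} (edgeTgt e) := by
  unfold netOut
  rw [Finset.sum_eq_single e]
  · simp
  · intro e' _ h
    simp [Pi.single_eq_of_ne h]
  · simp

theorem continuous_netOut (u : Vertex A) : Continuous fun x : NetEdge A → ℝ => netOut x u := by
  unfold netOut
  fun_prop

theorem EdgeFlow.isFeasible_iff : φ.IsFeasible p ↔ (∀ e, 0 ≤ φ.val e) ∧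
    (∀ B : ErrorEdge A, φ.val (Sum.inr B) ≤ p B.1) ∧ ∀ u, u ≠ ⊥ → u ≠ ⊤ → netOut φ.val u = 0 := by
  have hcons : ∀ u, netOut φ.val u = 0 ↔ φ.inflow u = φ.outflow u := fun u => by
    rw [netOut_val, sub_eq_zero, eq_comm]
  simp only [hcons, EdgeFlow.IsFeasible]
  refine ⟨fun ⟨h1, h2, h3⟩ => ⟨?_, fun B => (h2 B).2, h3⟩,
    fun ⟨h1, h2, h3⟩ => ⟨fun e => h1 (Sum.inl e), fun B => ⟨h1 (Sum.inr B), h2 B⟩, h3⟩⟩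
  rintro (e | B)
  · exact h1 e
  · exact (h2 B).1

theorem EdgeFlow.value_eq_netOut (φ : EdgeFlow A) : φ.value = netOut φ.val ⊤ := (netOut_val _ _).symm

/-- Sum the net outflow over the `t`-side: conservation leaves only `t`, and edges inside either
side cancel. -/
theorem EdgeFlow.IsFeasible.value_eq (h : φ.IsFeasible p) {X : Set (Vertex A)} (hb : ⊥ ∈ X)
    (ht : ⊤ ∉ X) :
    φ.value = ∑ e, φ.val e * (indic X (edgeTgt e) - indic X (edgeSrc e)) := by
  have h0 := (EdgeFlow.isFeasible_iff.1 h).2.2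
  let _ : Fintype (Vertex A) := Fintype.ofFinite _
  have h1 : ∑ u : Vertex A, (1 - indic X u) * netOut φ.val u = φ.value := by
    rw [Finset.sum_eq_single ⊤, φ.value_eq_netOut]
    · simp [indic, ht]
    · intro u _ hu
      by_cases hu' : u = ⊥
      · subst hu'
        simp [indic, hb]
      · rw [h0 u hu' hu, mul_zero]
    · simp
  have h2 : ∀ v : Vertex A, ∑ u, (1 - indic X u) * indic {u} v = 1 - indic X v := fun v => by
    rw [Finset.sum_eq_single v]
    · simp [indic]
    · intro u _ hu
      simp [indic, hu.symm]
    · simp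
  rw [← h1]
  unfold netOut
  simp only [Finset.mul_sum]
  rw [Finset.sum_comm]
  refine Finset.sum_congr rfl fun e _ => ?_
  have : ∀ u : Vertex A, (1 - indic X u) * (φ.val e * (indic {u} (edgeSrc e) - indic {u} (edgeTgt e)))
      = φ.val e * ((1 - indic X u) * indic {u} (edgeSrc e)) -
        φ.val e * ((1 - indic X u) * indic {u} (edgeTgt e)) := fun u => by ring
  simp only [this]
  rw [Finset.sum_sub_distrib, ← Finset.mul_sum, ← Finset.mul_sum, h2, h2]
  ring

/-- Supplies the bound that infinite capacities do not. Cut at the lower set generated by the source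
of `e`: no Hasse edge enters it and `e` leaves it, so with nonnegative value the flow on `e` is at
most what the error edges bring in. -/
theorem EdgeFlow.IsFeasible.f_le (h : φ.IsFeasible p) (hv : 0 ≤ φ.value) (e : HasseEdge A) :
    φ.f e ≤ ∑ B : ErrorEdge A, p B.1 := by
  have ht : (⊤ : Vertex A) ∉ Set.Iic e.1.1 := fun ht => e.2.lt.not_ge (le_top.trans ht)
  have h1 := h.value_eq (X := Set.Iic e.1.1) (Set.mem_Iic.2 bot_le) ht
  rw [Fintype.sum_sum_type] at h1
  have h2 : ∑ e' : HasseEdge A, φ.val (Sum.inl e') * (indic (Set.Iic e.1.1) (edgeTgt (Sum.inl e')) -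
      indic (Set.Iic e.1.1) (edgeSrc (Sum.inl e'))) ≤ - φ.f e := by
    rw [← neg_le_neg_iff, neg_neg, ← Finset.sum_neg_distrib]
    have key : ∀ e' : HasseEdge A, indic (Set.Iic e.1.1) (edgeTgt (Sum.inl e')) ≤
        indic (Set.Iic e.1.1) (edgeSrc (Sum.inl e')) := fun e' => by
      unfold indic
      split_ifs with k1 k2
      · exact le_rfl
      · exact absurd (e'.2.le.trans k1) k2
      · exact zero_le_one
      · exact le_rfl
    refine le_trans (le_of_eq ?_) (Finset.single_le_sum (fun e' _ => ?_) (Finset.mem_univ e))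
    · have k1 : indic (Set.Iic e.1.1) (edgeTgt (Sum.inl e)) = 0 := if_neg e.2.lt.not_ge
      have k2 : indic (Set.Iic e.1.1) (edgeSrc (Sum.inl e)) = 1 := if_pos (le_refl e.1.1)
      rw [k1, k2]
      simp [EdgeFlow.val]
    · have := mul_nonneg (h.1 e') (sub_nonneg.2 (key e'))
      have e2 : φ.val (Sum.inl e') = φ.f e' := rfl
      rw [e2]
      linarith
  have h3 : ∑ B : ErrorEdge A, φ.val (Sum.inr B) * (indic (Set.Iic e.1.1) (edgeTgt (Sum.inr B)) -
      indic (Set.Iic e.1.1) (edgeSrc (Sum.inr B))) ≤ ∑ B : ErrorEdge A, p B.1 := by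
    refine Finset.sum_le_sum fun B _ => ?_
    obtain ⟨k1, k2⟩ := h.2.1 B
    refine le_trans ?_ k2
    refine mul_le_of_le_one_right k1 ?_
    unfold indic
    split_ifs <;> norm_num
  linarith

theorem exists_isMaximum (hp : ∀ B, 0 ≤ p B) : ∃ φ : EdgeFlow A, φ.IsMaximum p := by
  let F : (NetEdge A → ℝ) → EdgeFlow A := fun x => ⟨fun e => x (Sum.inl e), fun B => x (Sum.inr B)⟩
  have hF : ∀ x, (F x).val = x := fun x => by
    funext e
    cases e <;> rfl
  have hF' : ∀ φ : EdgeFlow A, F φ.val = φ := fun _ => rfl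
  have feas : ∀ x, (F x).IsFeasible p ↔ (∀ e, 0 ≤ x e) ∧
      (∀ B : ErrorEdge A, x (Sum.inr B) ≤ p B.1) ∧ ∀ u, u ≠ ⊥ → u ≠ ⊤ → netOut x u = 0 := fun x => by
    rw [EdgeFlow.isFeasible_iff, hF]
  have hval : ∀ x, (F x).value = netOut x ⊤ := fun x => by rw [EdgeFlow.value_eq_netOut, hF]
  set C := ∑ B : ErrorEdge A, p B.1
  -- Only flows of nonnegative value are known to be bounded; the zero flow shows that no maximum is
  -- lost by this restriction.
  let K : Set (NetEdge A → ℝ) := {x | (F x).IsFeasible p ∧ 0 ≤ (F x).value}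
  have hK : K = {x | (∀ e, 0 ≤ x e) ∧ (∀ B : ErrorEdge A, x (Sum.inr B) ≤ p B.1) ∧
      (∀ u, u ≠ ⊥ → u ≠ ⊤ → netOut x u = 0) ∧ 0 ≤ netOut x ⊤} := by
    ext x
    simp only [K, Set.mem_ofPred_eq, feas, hval, and_assoc]
  have hclosed : IsClosed K := by
    rw [hK]
    simp only [Set.ofPred_and, Set.ofPred_forall]
    refine IsClosed.inter (isClosed_iInter fun e => isClosed_le continuous_const
      (continuous_apply e)) (IsClosed.inter (isClosed_iInter fun B => isClosed_le
        (continuous_apply _) continuous_const) (IsClosed.inter (isClosed_iInter fun u =>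
          isClosed_iInter fun _ => isClosed_iInter fun _ => isClosed_eq (continuous_netOut u)
            continuous_const) (isClosed_le continuous_const (continuous_netOut ⊤))))
  have hsub : K ⊆ Set.Icc (fun _ => 0) (fun _ => C) := by
    rintro x ⟨h1, h2⟩
    have h3 := (feas x).1 h1
    refine ⟨h3.1, fun e => ?_⟩
    rcases e with e | B
    · exact h1.f_le h2 e
    · exact (h3.2.1 B).trans (Finset.single_le_sum (f := fun B : ErrorEdge A => p B.1)
        (fun B _ => hp B.1) (Finset.mem_univ B))
  have hcomp : IsCompact K := isCompact_Icc.of_isClosed_subset hclosed hsub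
  have hne : K.Nonempty := by
    refine ⟨fun _ => 0, ?_⟩
    rw [hK]
    simp [netOut, hp]
  obtain ⟨x, hx, hmax⟩ := hcomp.exists_isMaxOn hne (continuous_netOut ⊤).continuousOn
  refine ⟨F x, hx.1, fun ψ hψ => ?_⟩
  by_cases hψv : 0 ≤ ψ.value
  · have h1 : ψ.val ∈ K := ⟨by rwa [hF'], by rwa [hF']⟩
    have h2 := hmax h1
    rw [ψ.value_eq_netOut, hval]
    exact h2
  · exact (not_le.1 hψv).le.trans hx.2

/-- The edge can carry more flow. -/
def EdgeFlow.BelowCap (p : Shift A → ℝ) (φ : EdgeFlow A) : NetEdge A → Prop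
  | Sum.inl _ => True
  | Sum.inr B => φ.g B < p B.1

theorem EdgeFlow.residual_iff {u v : Vertex A} : φ.Residual p u v ↔
    (∃ e, edgeSrc e = u ∧ edgeTgt e = v ∧ φ.BelowCap p e) ∨
      ∃ e, edgeSrc e = v ∧ edgeTgt e = u ∧ 0 < φ.val e := by
  unfold EdgeFlow.Residual
  simp only [Sum.exists, edgeSrc, edgeTgt, EdgeFlow.BelowCap, EdgeFlow.val, Sum.elim_inl,
    Sum.elim_inr, and_true]
  exact or_assoc.symm.trans or_or_or_comm

/-- `δ` is the signed unit flow along a residual path: each forward step adds one on its edge, each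
reversed step subtracts one. -/
theorem exists_direction {v : Vertex A} (h : φ.Reach p ⊤ v) : ∃ δ : NetEdge A → ℝ,
    (∀ e, δ e < 0 → 0 < φ.val e) ∧ (∀ e, 0 < δ e → φ.BelowCap p e) ∧
      ∀ u, netOut δ u = indic {u} ⊤ - indic {u} v := by
  induction h with
  | refl => exact ⟨fun _ => 0, by simp, by simp, fun u => by simp [netOut]⟩
  | tail _ hr ih =>
    obtain ⟨δ, h1, h2, h3⟩ := ih
    rcases EdgeFlow.residual_iff.1 hr with ⟨e, rfl, rfl, he⟩ | ⟨e, rfl, rfl, he⟩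
    · refine ⟨fun e' => δ e' + 1 * (Pi.single e 1 : NetEdge A → ℝ) e', fun e' h => ?_,
        fun e' h => ?_, fun u => ?_⟩
      · by_cases hee : e' = e
        · subst hee
          refine h1 _ ?_
          simp at h
          linarith
        · exact h1 _ (by simpa [Pi.single_eq_of_ne hee] using h)
      · by_cases hee : e' = e
        · rwa [hee]
        · exact h2 _ (by simpa [Pi.single_eq_of_ne hee] using h)
      · rw [netOut_add_smul, h3, netOut_single]
        ring
    · refine ⟨fun e' => δ e' + (-1) * (Pi.single e 1 : NetEdge A → ℝ) e', fun e' h => ?_,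
        fun e' h => ?_, fun u => ?_⟩
      · by_cases hee : e' = e
        · rwa [hee]
        · exact h1 _ (by simpa [Pi.single_eq_of_ne hee] using h)
      · by_cases hee : e' = e
        · subst hee
          refine h2 _ ?_
          simp at h
          linarith
        · exact h2 _ (by simpa [Pi.single_eq_of_ne hee] using h)
      · rw [netOut_add_smul, h3, netOut_single]
        ring

/-- A maximum flow has no augmenting path. -/
theorem EdgeFlow.IsMaximum.not_reach (h : φ.IsMaximum p) : ¬ φ.Reach p ⊤ ⊥ := by
  intro hr
  obtain ⟨δ, h1, h2, h3⟩ := exists_direction hr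
  obtain ⟨hf, hmax⟩ := h
  obtain ⟨k1, k2, k3⟩ := EdgeFlow.isFeasible_iff.1 hf
  -- The finitely many constraints survive a sufficiently small positive multiple of `δ`, which
  -- would raise the value.
  have lim : ∀ e, Tendsto (fun ε : ℝ => φ.val e + ε * δ e) (𝓝[>] 0) (𝓝 (φ.val e)) := fun e => by
    have : Continuous fun ε : ℝ => φ.val e + ε * δ e := by fun_prop
    simpa using (this.tendsto 0).mono_left nhdsWithin_le_nhds
  have e1 : ∀ᶠ ε in 𝓝[>] (0 : ℝ), ∀ e, 0 ≤ φ.val e + ε * δ e := by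
    refine eventually_all.2 fun e => ?_
    by_cases hδ : δ e < 0
    · filter_upwards [(lim e).eventually (lt_mem_nhds (h1 e hδ))] with ε hε using hε.le
    · filter_upwards [self_mem_nhdsWithin] with ε hε
      exact add_nonneg (k1 e) (mul_nonneg (le_of_lt hε) (not_lt.1 hδ))
  have e2 : ∀ᶠ ε in 𝓝[>] (0 : ℝ), ∀ B : ErrorEdge A,
      φ.val (Sum.inr B) + ε * δ (Sum.inr B) ≤ p B.1 := by
    refine eventually_all.2 fun B => ?_
    by_cases hδ : 0 < δ (Sum.inr B)
    · have hlt : φ.val (Sum.inr B) < p B.1 := h2 _ hδ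
      filter_upwards [(lim (Sum.inr B)).eventually (gt_mem_nhds hlt)] with ε hε using hε.le
    · filter_upwards [self_mem_nhdsWithin] with ε hε
      have := mul_nonpos_of_nonneg_of_nonpos (le_of_lt hε) (not_lt.1 hδ)
      linarith [k2 B]
  obtain ⟨ε, ⟨hε1, hε2⟩, hε⟩ := ((e1.and e2).and self_mem_nhdsWithin).exists
  let ψ : EdgeFlow A := ⟨fun e => φ.val (Sum.inl e) + ε * δ (Sum.inl e),
    fun B => φ.val (Sum.inr B) + ε * δ (Sum.inr B)⟩
  have hψ : ψ.val = fun e => φ.val e + ε * δ e := by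
    funext e
    cases e <;> rfl
  have hψf : ψ.IsFeasible p := by
    rw [EdgeFlow.isFeasible_iff, hψ]
    refine ⟨hε1, hε2, fun u hu hu' => ?_⟩
    rw [netOut_add_smul, k3 u hu hu', h3]
    simp [indic, hu.symm, hu'.symm]
  have hle := hmax ψ hψf
  rw [ψ.value_eq_netOut, φ.value_eq_netOut, hψ, netOut_add_smul, h3] at hle
  have : indic {(⊤ : Vertex A)} ⊤ - indic {(⊤ : Vertex A)} ⊥ = 1 := by
    simp [indic, bot_ne_top_vertex]
  rw [this] at hle
  have hε' : 0 < ε := hε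
  linarith

/-- Closed under predecessors in the residual graph. -/
def PredClosed (p : Shift A → ℝ) (φ : EdgeFlow A) (X : Set (Vertex A)) : Prop :=
  ∀ u v, φ.Residual p u v → v ∈ X → u ∈ X

theorem PredClosed.of_reach {X : Set (Vertex A)} (h : PredClosed p φ X) {u v : Vertex A}
    (huv : φ.Reach p u v) (hv : v ∈ X) : u ∈ X := by
  induction huv using Relation.ReflTransGen.head_induction_on with
  | refl => exact hv
  | head hr _ ih => exact h _ _ hr ih

theorem vertex_le_antisymm {u v : Vertex A} (h : u ≤ v) (h' : v ≤ u) : u = v := by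
  rcases vertex_cases u with rfl | rfl | ⟨ρ, rfl⟩ <;> rcases vertex_cases v with rfl | rfl | ⟨σ, rfl⟩
  · rfl
  · exact absurd h' not_top_le_bot_vertex
  · exact absurd h' (not_rotVertex_le_bot σ)
  · exact absurd h not_top_le_bot_vertex
  · rfl
  · exact absurd h (not_top_le_rotVertex σ)
  · exact absurd h (not_rotVertex_le_bot ρ)
  · exact absurd h' (not_top_le_rotVertex ρ)
  · rw [rotation_le_antisymm (rotVertex_le.1 h) (rotVertex_le.1 h')]

/-- Hasse edges are never saturated, so they are all residual, and comparable vertices of a finite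
order are joined by a chain of covers. -/
theorem PredClosed.isLowerSet {X : Set (Vertex A)} (h : PredClosed p φ X) : IsLowerSet X := by
  intro v u huv hv
  by_cases hvu : v ≤ u
  · rwa [vertex_le_antisymm huv hvu]
  let _ : Fintype (Vertex A) := Fintype.ofFinite _
  let _ : LocallyFiniteOrder (Vertex A) := Fintype.toLocallyFiniteOrder
  refine h.of_reach (u := u) ?_ hv
  have h1 := (transGen_covBy_of_lt (lt_of_le_not_ge huv hvu)).to_reflTransGen
  have h2 : ∀ a b : Vertex A, a ⋖ b → φ.Residual p a b :=
    fun a b hab => Or.inl ⟨⟨(a, b), hab⟩, rfl, rfl⟩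
  exact Relation.ReflTransGen.mono h2 _ _ h1

/-- The capacity of the cut given by the side `X` of `s`. -/
noncomputable def cutCap (p : Shift A → ℝ) (X : Set (Vertex A)) : ℝ :=
  ∑ B : ErrorEdge A, if inVertex A B.1 ∈ X ∧ outVertex A B.1 ∉ X then p B.1 else 0

/-- Complementary slackness. Capacity minus value is a sum of nonnegative terms, one per edge; a
term is positive exactly when its edge gives a residual edge entering `X` from outside. -/
theorem cutCap_sub_value (h : φ.IsFeasible p) {X : Set (Vertex A)} (hb : ⊥ ∈ X) (ht : ⊤ ∉ X)
    (hX : IsLowerSet X) : φ.value ≤ cutCap p X ∧ (φ.value = cutCap p X ↔ PredClosed p φ X) := by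
  have hval := h.value_eq hb ht
  rw [Fintype.sum_sum_type] at hval
  let a : HasseEdge A → ℝ := fun e => φ.f e * (indic X e.1.1 - indic X e.1.2)
  let c : ErrorEdge A → ℝ := fun B => (if inVertex A B.1 ∈ X ∧ outVertex A B.1 ∉ X then p B.1 else 0)
    - φ.g B * (indic X (inVertex A B.1) - indic X (outVertex A B.1))
  have hdiff : cutCap p X - φ.value = ∑ e, a e + ∑ B, c B := by
    simp only [a, c, Finset.sum_sub_distrib, hval, cutCap, mul_sub, EdgeFlow.val, Sum.elim_inl,
      Sum.elim_inr, edgeSrc, edgeTgt]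
    ring
  have ha : ∀ e, 0 ≤ a e := fun e => by
    refine mul_nonneg (h.1 e) ?_
    unfold indic
    split_ifs with k1 k2 k2
    · norm_num
    · norm_num
    · exact absurd (hX e.2.le k2) k1
    · norm_num
  have hc : ∀ B, 0 ≤ c B := fun B => by
    obtain ⟨k1, k2⟩ := h.2.1 B
    simp only [c, indic]
    split_ifs <;> simp_all
  have hsa : 0 ≤ ∑ e, a e := Finset.sum_nonneg fun e _ => ha e
  have hsc : 0 ≤ ∑ B, c B := Finset.sum_nonneg fun B _ => hc B
  refine ⟨by linarith, ?_⟩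
  have hiff : φ.value = cutCap p X ↔ (∀ e, a e = 0) ∧ ∀ B, c B = 0 := by
    have k1 := Finset.sum_eq_zero_iff_of_nonneg (s := Finset.univ) (f := a) fun e _ => ha e
    have k2 := Finset.sum_eq_zero_iff_of_nonneg (s := Finset.univ) (f := c) fun B _ => hc B
    simp only [Finset.mem_univ, true_imp_iff] at k1 k2
    rw [← k1, ← k2]
    constructor
    · intro he
      constructor <;> linarith
    · rintro ⟨he1, he2⟩
      linarith
  rw [hiff]
  constructor
  · rintro ⟨k1, k2⟩ u v hr hv
    by_contra hu
    rcases hr with ⟨e, rfl, rfl⟩ | ⟨e, rfl, rfl, hpos⟩ | ⟨B, rfl, rfl, hlt⟩ | ⟨B, rfl, rfl, hpos⟩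
    · exact hu (hX e.2.le hv)
    · have := k1 e
      simp [a, indic, hv, hu] at this
      linarith
    · have := k2 B
      simp [c, indic, hv, hu] at this
      linarith
    · have := k2 B
      simp [c, indic, hv, hu] at this
      linarith
  · intro hcl
    refine ⟨fun e => ?_, fun B => ?_⟩
    · by_cases k1 : e.1.1 ∈ X <;> by_cases k2 : e.1.2 ∈ X
      · simp [a, indic, k1, k2]
      · have : ¬ 0 < φ.f e := fun hpos => k2 (hcl _ _ (Or.inr (Or.inl ⟨e, rfl, rfl, hpos⟩)) k1)
        have h0 : φ.f e = 0 := le_antisymm (not_lt.1 this) (h.1 e)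
        simp [a, h0]
      · exact absurd (hX e.2.le k2) k1
      · simp [a, indic, k1, k2]
    · obtain ⟨l1, l2⟩ := h.2.1 B
      by_cases k1 : inVertex A B.1 ∈ X <;> by_cases k2 : outVertex A B.1 ∈ X
      · simp [c, indic, k1, k2]
      · have : ¬ φ.g B < p B.1 :=
          fun hlt => k2 (hcl _ _ (Or.inr (Or.inr (Or.inl ⟨B, rfl, rfl, hlt⟩))) k1)
        have h0 : φ.g B = p B.1 := le_antisymm l2 (not_lt.1 this)
        simp [c, indic, k1, k2, h0]
      · have : ¬ 0 < φ.g B :=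
          fun hpos => k1 (hcl _ _ (Or.inr (Or.inr (Or.inr ⟨B, rfl, rfl, hpos⟩))) k2)
        have h0 : φ.g B = 0 := le_antisymm (not_lt.1 this) l1
        simp [c, indic, k1, k2, h0]
      · simp [c, indic, k1, k2]

theorem EdgeFlow.IsMaximum.exists_predClosed (h : φ.IsMaximum p) :
    ∃ X : Set (Vertex A), ⊥ ∈ X ∧ ⊤ ∉ X ∧ PredClosed p φ X :=
  -- The `s`-side consists of the vertices that `t` cannot reach.
  ⟨{v | ¬ φ.Reach p ⊤ v}, h.not_reach, fun h => h Relation.ReflTransGen.refl,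
    fun _ _ hr hv hu => hv (Relation.ReflTransGen.tail hu hr)⟩

/-- For a shift with an edge, `M` is stable or the edge crosses the cut, never both, so the two
terms sum to `p B`. The other shifts contribute equally for `M` and `N`. -/
theorem probStable_add_cutCap {M N : Pairing Boy Girl} (hM : Stable A M) (hN : Stable A N) :
    probStable A p M + cutCap p (sideSet (elimSet A M)) =
      probStable A p N + cutCap p (sideSet (elimSet A N)) := by
  have hcut : ∀ X : Set (Vertex A), cutCap p X = ∑ B : Shift A,
      if (rotationsInto A B).Nonempty ∨ (rotationsOutOf A B).Nonempty then
        (if inVertex A B ∈ X ∧ outVertex A B ∉ X then p B else 0) else 0 := fun X => by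
    rw [← Finset.sum_filter]
    exact (Finset.sum_subtype _ (by simp)
      (fun B => if inVertex A B ∈ X ∧ outVertex A B ∉ X then p B else 0)).symm
  unfold probStable
  rw [hcut, hcut, ← Finset.sum_add_distrib, ← Finset.sum_add_distrib]
  refine Finset.sum_congr rfl fun B _ => ?_
  have lost : ∀ L, Stable A L → (Stable (A.applyShift B) L ↔ L ∉ lostSet A B) := fun L hL => by
    simp [lostSet, hL]
  by_cases hB : (rotationsInto A B).Nonempty ∨ (rotationsOutOf A B).Nonempty
  · have key : ∀ L, Stable A L → ((if Stable (A.applyShift B) L then p B else 0) +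
        if inVertex A B ∈ sideSet (elimSet A L) ∧ outVertex A B ∉ sideSet (elimSet A L) then p B
          else 0) = p B := fun L hL => by
      have h1 := mem_lostSet_iff_of_errorEdge ⟨B, hB⟩ hL
      simp only at h1
      simp only [lost L hL, h1]
      split_ifs <;> simp
    rw [if_pos hB, if_pos hB, key M hM, key N hN]
  · rw [if_neg hB, if_neg hB]
    have h1 := mem_lostSet_iff_of_not_errorEdge hB hM hN
    simp only [lost M hM, lost N hN, h1]

theorem EdgeFlow.IsMaximum.mem_robustSet_iff (h : φ.IsMaximum p) {M : Pairing Boy Girl}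
    (hM : Stable A M) : M ∈ robustSet A p ↔ PredClosed p φ (sideSet (elimSet A M)) := by
  have cut : ∀ N, Stable A N → φ.value ≤ cutCap p (sideSet (elimSet A N)) ∧
      (φ.value = cutCap p (sideSet (elimSet A N)) ↔ PredClosed p φ (sideSet (elimSet A N))) :=
    fun N hN => cutCap_sub_value h.1 (bot_mem_sideSet _) (top_notMem_sideSet _)
      (isLowerSet_sideSet (isLowerSet_elimSet hN))
  constructor
  · intro hrob
    obtain ⟨X, h1, h2, h3⟩ := h.exists_predClosed
    have hlow : IsLowerSet {ρ : Rotation A | rotVertex ρ ∈ X} :=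
      fun ρ σ hσρ hρ => h3.isLowerSet (rotVertex_le.2 hσρ) hρ
    obtain ⟨N, hN, hNe⟩ := exists_elimSet_eq hlow
    have hX := sideSet_eq h1 h2
    rw [← hNe] at hX
    have k1 := (cut N hN).2.2 (by rwa [hX])
    have k2 := probStable_add_cutCap (p := p) hM hN
    have k3 := hrob.2 N hN
    exact (cut M hM).2.1 (le_antisymm (cut M hM).1 (by linarith))
  · intro hcl
    refine ⟨hM, fun N hN => ?_⟩
    have k1 := (cut M hM).2.2 hcl
    have k2 := (cut N hN).1
    have k3 := probStable_add_cutCap (p := p) hM hN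
    linarith

end Flow

/-! ### Closed sets of components and robust matchings -/

section Components

set_option linter.unusedSectionVars false

variable {Boy Girl : Type*} [DecidableEq Boy] [DecidableEq Girl] [Fintype Boy] [Fintype Girl]
  {A : SMInstance Boy Girl} {p : Shift A → ℝ} {φ : EdgeFlow A}

theorem Pi0.mem_iff_eq_of {C : Pi0 p φ} {v : Vertex A} : v ∈ C.1 ↔ C = Pi0.of p φ v := by
  obtain ⟨C, w, rfl⟩ := C
  constructor
  · rintro ⟨h1, h2⟩
    exact Subtype.ext (Set.ext fun x => ⟨fun h => ⟨h2.trans h.1, h.2.trans h1⟩,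
      fun h => ⟨h1.trans h.1, h.2.trans h2⟩⟩)
  · intro h
    rw [h]
    exact ⟨Relation.ReflTransGen.refl, Relation.ReflTransGen.refl⟩

theorem Pi0.mem_of (v : Vertex A) : v ∈ (Pi0.of p φ v).1 := Pi0.mem_iff_eq_of.2 rfl

theorem Pi0.exists_of (C : Pi0 p φ) : ∃ v, C = Pi0.of p φ v := by
  obtain ⟨C, w, rfl⟩ := C
  exact ⟨w, rfl⟩

theorem Pi0.of_le_of_residual {u v : Vertex A} (h : φ.Residual p u v) :
    Pi0.of p φ u ≤ Pi0.of p φ v := by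
  by_cases he : Pi0.of p φ u = Pi0.of p φ v
  · rw [he]
  · exact Relation.ReflTransGen.single ⟨he, u, Pi0.mem_of u, v, Pi0.mem_of v, h⟩

theorem Pi0.reach_of_le {u v : Vertex A} (h : Pi0.of p φ u ≤ Pi0.of p φ v) : φ.Reach p u v :=
  Pi0.reach_of_path h (Pi0.mem_of u) (Pi0.mem_of v)

/-- The union of the components that belong to `S`. -/
def vertexUnion (S : LowerSet (Pi0 p φ)) : Set (Vertex A) := {v | Pi0.of p φ v ∈ S}

theorem predClosed_vertexUnion (S : LowerSet (Pi0 p φ)) : PredClosed p φ (vertexUnion S) :=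
  fun _ _ hr hv => S.lower (Pi0.of_le_of_residual hr) hv

theorem vertexUnion_subset_iff {S T : LowerSet (Pi0 p φ)} :
    vertexUnion S ⊆ vertexUnion T ↔ S ≤ T := by
  constructor
  · intro h C hC
    obtain ⟨v, rfl⟩ := C.exists_of
    exact h hC
  · exact fun h v hv => h hv

/-- The lower set of components that meet a set closed under residual predecessors. -/
def PredClosed.lowerSet {X : Set (Vertex A)} (h : PredClosed p φ X) : LowerSet (Pi0 p φ) where
  carrier := {C | ∃ v ∈ X, C = Pi0.of p φ v}
  lower' := by
    rintro _ D hD ⟨v, hv, rfl⟩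
    obtain ⟨w, rfl⟩ := D.exists_of
    exact ⟨w, h.of_reach (Pi0.reach_of_le hD) hv, rfl⟩

theorem PredClosed.vertexUnion_lowerSet {X : Set (Vertex A)} (h : PredClosed p φ X) :
    vertexUnion h.lowerSet = X := by
  ext v
  constructor
  · rintro ⟨w, hw, he⟩
    exact h.of_reach (Pi0.reach_of_le he.le) hw
  · exact fun hv => ⟨v, hv, rfl⟩

theorem unionOfRotations_eq (S : LowerSet (Pi0 p φ)) :
    unionOfRotations S = {ρ | rotVertex ρ ∈ vertexUnion S} := by
  ext ρ
  constructor
  · rintro ⟨C, hC, hρ⟩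
    rw [Pi0.mem_iff_eq_of.1 hρ] at hC
    exact hC
  · exact fun h => ⟨_, h, Pi0.mem_of _⟩

theorem sideSet_unionOfRotations {S : LowerSet (Pi0 p φ)} (hS : S ∈ closedSets p φ) :
    sideSet (unionOfRotations S) = vertexUnion S := by
  rw [unionOfRotations_eq]
  exact sideSet_eq hS.1 hS.2

theorem unionOfRotations_subset_iff {S T : LowerSet (Pi0 p φ)} (hS : S ∈ closedSets p φ)
    (hT : T ∈ closedSets p φ) : unionOfRotations S ⊆ unionOfRotations T ↔ S ≤ T := by
  rw [← vertexUnion_subset_iff]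
  constructor
  · intro h
    rw [← sideSet_unionOfRotations hS, ← sideSet_unionOfRotations hT]
    exact sideSet_mono h
  · intro h
    rw [unionOfRotations_eq, unionOfRotations_eq]
    exact fun ρ hρ => h hρ

theorem unionOfRotations_inf (S T : LowerSet (Pi0 p φ)) :
    unionOfRotations (S ⊓ T) = unionOfRotations S ∩ unionOfRotations T := by
  simp only [unionOfRotations_eq]
  rfl

theorem unionOfRotations_sup (S T : LowerSet (Pi0 p φ)) :
    unionOfRotations (S ⊔ T) = unionOfRotations S ∪ unionOfRotations T := by
  simp only [unionOfRotations_eq]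
  rfl

theorem isLowerSet_unionOfRotations (S : LowerSet (Pi0 p φ)) :
    IsLowerSet (unionOfRotations S) := by
  rw [unionOfRotations_eq]
  exact fun ρ σ hσρ hρ => (predClosed_vertexUnion S).isLowerSet (rotVertex_le.2 hσρ) hρ

/-- The bijection between the closed sets of `Π₀` and the robust stable matchings. -/
theorem exists_equiv_robustSet (h : φ.IsMaximum p) : ∃ Φ : closedSets p φ ≃ robustSet A p,
    ∀ S, elimSet A (Φ S).1 = unionOfRotations S.1 := by
  choose F hF hFe using fun S : closedSets p φ =>
    exists_elimSet_eq (isLowerSet_unionOfRotations S.1)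
  have hrob : ∀ S, F S ∈ robustSet A p := fun S => by
    rw [h.mem_robustSet_iff (hF S), hFe, sideSet_unionOfRotations S.2]
    exact predClosed_vertexUnion S.1
  refine ⟨Equiv.ofBijective (fun S => ⟨F S, hrob S⟩) ⟨fun S T hST => ?_, fun M => ?_⟩, hFe⟩
  · have he : unionOfRotations S.1 = unionOfRotations T.1 := by
      rw [← hFe S, ← hFe T]
      exact congrArg (fun M => elimSet A M.1) hST
    exact Subtype.ext (le_antisymm ((unionOfRotations_subset_iff S.2 T.2).1 he.subset)
      ((unionOfRotations_subset_iff T.2 S.2).1 he.symm.subset))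
  · have hcl := (h.mem_robustSet_iff M.2.1).1 M.2
    have hv := hcl.vertexUnion_lowerSet
    have hS : hcl.lowerSet ∈ closedSets p φ := by
      constructor
      · change ⊥ ∈ vertexUnion hcl.lowerSet
        rw [hv]
        exact bot_mem_sideSet _
      · change ⊤ ∉ vertexUnion hcl.lowerSet
        rw [hv]
        exact top_notMem_sideSet _
    refine ⟨⟨hcl.lowerSet, hS⟩, Subtype.ext (elimSet_injective (hF _) M.2.1 ?_)⟩
    rw [hFe, unionOfRotations_eq, hv]
    ext ρ
    exact rotVertex_mem_sideSet

theorem isMeet_of_elimSet {M N K : Pairing Boy Girl} (hM : Stable A M) (hN : Stable A N)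
    (hK : Stable A K) (h : elimSet A K = elimSet A M ∩ elimSet A N) : IsMeet A M N K := by
  obtain ⟨L, hL, h1, h2, -⟩ := exists_meet hM hN
  obtain rfl := elimSet_injective hK hL (h.trans (mem_elimSet_of_min hM hN hL h2).symm)
  exact h1

theorem isJoin_of_elimSet {M N K : Pairing Boy Girl} (hM : Stable A M) (hN : Stable A N)
    (hK : Stable A K) (h : elimSet A K = elimSet A M ∪ elimSet A N) : IsJoin A M N K := by
  obtain ⟨L, hL, h1, h2, -⟩ := exists_join hM hN
  obtain rfl := elimSet_injective hK hL (h.trans (mem_elimSet_of_max h2).symm)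
  exact h1

end Components

end RobustSM

/-! ### The main theorem -/

open RobustSM in
theorem lemma4p5 {Boy Girl : Type*} [Fintype Boy] [Fintype Girl] [DecidableEq Boy]
    [DecidableEq Girl] (A : SMInstance Boy Girl) (p : Shift A → ℝ) (hp : ∀ B, 0 ≤ p B)
    (hp_sum : ∑ B, p B = 1) :
    (∃ φ : EdgeFlow A, φ.IsMaximum p) ∧
    ∀ φ : EdgeFlow A, φ.IsMaximum p →
      IsStableSublattice A (robustSet A p) ∧
      ∃ Φ : closedSets p φ ≃ robustSet A p,
        (∀ S T, S ≤ T ↔ Dominates A (Φ S).1 (Φ T).1) ∧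
        (∀ S T, IsMeet A (Φ S).1 (Φ T).1 (Φ (S ⊓ T)).1) ∧
        (∀ S T, IsJoin A (Φ S).1 (Φ T).1 (Φ (S ⊔ T)).1) ∧
        ∀ S, Generates A (unionOfRotations S.1) (Φ S).1 := by
  refine ⟨exists_isMaximum hp, fun φ hφ => ?_⟩
  obtain ⟨Φ, hΦ⟩ := exists_equiv_robustSet hφ
  have st : ∀ S, Stable A (Φ S).1 := fun S => (Φ S).2.1
  have meet : ∀ S T, IsMeet A (Φ S).1 (Φ T).1 (Φ (S ⊓ T)).1 := fun S T =>
    isMeet_of_elimSet (st S) (st T) (st _) (by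
      rw [hΦ, hΦ, hΦ]
      exact unionOfRotations_inf S.1 T.1)
  have join : ∀ S T, IsJoin A (Φ S).1 (Φ T).1 (Φ (S ⊔ T)).1 := fun S T =>
    isJoin_of_elimSet (st S) (st T) (st _) (by
      rw [hΦ, hΦ, hΦ]
      exact unionOfRotations_sup S.1 T.1)
  refine ⟨⟨fun M hM => hM.1, fun M hM N hN => ?_⟩, Φ, fun S T => ?_, meet, join, fun S => ?_⟩
  · obtain ⟨S, hS⟩ := Φ.surjective ⟨M, hM⟩
    obtain ⟨T, hT⟩ := Φ.surjective ⟨N, hN⟩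
    have h1 := meet S T
    have h2 := join S T
    rw [hS, hT] at h1 h2
    exact ⟨⟨_, (Φ (S ⊓ T)).2, h1⟩, _, (Φ (S ⊔ T)).2, h2⟩
  · rw [dominates_iff_elimSet_subset (st S) (st T), hΦ, hΦ, unionOfRotations_subset_iff S.2 T.2]
    rfl
  · rw [← hΦ]
    exact generates_elimSet (st S)
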